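/- **Domain languages.** Let $\mathcal F$ (fluents, non-empty), $\mathcal A$ (actions), $\mathcal V$ (values) be finite sets, $\mathcal F\cap\mathcal A=\emptyset$, with two distinct values $\top,\bot\in\mathcal V$ and a map $vals$ assigning to each $X\in\mathcal F\cup\mathcal A$ a non-empty subset of $\mathcal V$, with $vals(A)=\{\top,\bot\}$ for $A\in\mathcal A$. The instants are $\mathcal I=\{0,1,\dots,maxinst\}\subset\mathbb N$ with the usual order. A literal is $X=V$ with $V\in vals(X)$; it is a fluent literal if $X\in\mathcal F$. Formulas are built from literals by $\wedge,\neg$; $\theta$ Herbrand-entails $\theta'$ if $\theta'$ holds whenever $\theta$ does under every truth assignment to the literals regarded as propositional variables. A state is a set of literals, exactly one for each $X\in\mathcal F\cup\mathcal A$; a partial state is a subset of a state; $X\restriction\mathcal F$ is the set of fluent literals in $X$, called a (partial) fluent state if $X$ is a (partial) state. An outcome is a pair $O=(\chi(O),\pi(O))$ of a partial fluent state and a real in $(0,1]$. **Domain descriptions.** A domain description $\mathcal D$ is a finite set of: v-propositions "$F$ takes-values $vals(F)$", exactly one for each $F\in\mathcal F$; c-propositions "$\theta$ causes-one-of $\{O_1,\dots,O_m\}$"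 with pairwise distinct $\chi(O_i)$, $\sum_i\pi(O_i)=1$, and $\theta$ Herbrand-entailing $A=\top$ for some action $A$, such that for distinct c-propositions the body $\theta$ of one never Herbrand-entails the body of the other; exactly one i-proposition "initially-one-of $\{O_1,\dots,O_m\}$" with pairwise distinct $\chi(O_i)$, all fluent states, and $\sum_i\pi(O_i)=1$; and p-propositions "$A$ performed-at $I$ with-prob $P$" with $P\in(0,1]$ and $I<maxinst$, at most one for each pair $(A,I)$. **Traces of $\mathcal D$.** A world is a map $W$ from $\mathcal I$ to states. A c-proposition of $\mathcal D$ is activated at $I$ in $W$ if its body is true in $W(I)$, and $occ(W)$ is the set of instants at which some c-proposition of $\mathcal D$ is activated. An effect choice for $W$ is a function $ec$ assigning to each $I\in occ(W)$ an outcome of the (if there are several: of some) c-proposition activated at $I$; an initial choice is an outcome $ic$ of the i-proposition. $W$ and $ic$ are consistent if $W(0)\restriction\mathcal F=\chi(ic)$. $W$ and $ec$ are consistent if for all $I<I'$, with $occ(W)\cap[I,I')=\{I_1<\dots<I_n\}$, one has $W(I')\restriction\mathcal F=(W(I)\restriction\mathcal F)\oplus\chi(ec(I_1))\oplus\dots\oplus\chi(ec(I_n))$,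 where $\tilde S\oplus\tilde X$ is obtained from $\tilde S$ by removing the literals whose fluent occurs in $\tilde X$ and adding $\tilde X$ ($\oplus$ is left-associative). $W$ is well-behaved if (a) $(A=\top)\in W(I)$ implies that $\mathcal D$ contains some "$A$ performed-at $I$ with-prob $P$", and is implied by "$A$ performed-at $I$ with-prob $1$" $\in\mathcal D$; (b) $W$ is consistent with some initial choice; (c) $W$ is consistent with some effect choice. A candidate trace $tr$ assigns an outcome $tr(\ast)$ to a new symbol $\ast\notin\mathcal I$ and an outcome $tr(I)$ to every $I$ in a set $dom(tr)\subseteq\mathcal I$. It is a trace of $\mathcal D$ if there are a well-behaved world $W$, an initial choice $ic$ and an effect choice $ec$, both consistent with $W$, such that $dom(tr)=occ(W)$, $tr(\ast)=ic$ and $tr(I)=ec(I)$ for $I\in dom(tr)$. **The program.** Constants of the language are written in lower case in the program, with $\top,\bot$ written $true,false$; literals $X=V$ become pairs $(x,v)$; instants and probabilities become numerals. Fix enumerations without repetition of the c-propositions of $\mathcal D$ and of the outcomes of each c-proposition and of the i-proposition; let $id^n_i$ be pairwise distinct new constants. For each c-proposition fix a disjunctive normal form $\theta_1\vee\dots\vee\theta_k$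 of its body, i.e. a disjunction of conjunctions of literals that has the same truth value as the body in every state, and let $holds([\theta]@I)$ be the disjunction of the conjunctions $holds([\theta_j]@I)$ of the atoms $holds(((x,v),I))$, $X=V$ in $\theta_j$. $\Pi_{\mathcal D}$ consists of - the facts $fluent(f)$, $action(a)$, $instant(i)$ for all fluents, actions and instants; - the facts $possVal(f,v)$ for $V\in vals(F)$; - for the $n$-th c-proposition ($n\ge1$) and its $i$-th outcome $O_i$: the facts $belongsTo((x,v),id^n_i)$ for $(X=V)\in\chi(O_i)$ and the rule $causesOutcome((id^n_i,\pi(O_i)),I)\leftarrow holds([\theta]@I)$; - for the $i$-th outcome $O_i$ of the i-proposition: the facts $belongsTo((x,v),id^0_i)$ for $(X=V)\in\chi(O_i)$ and $initialCondition((id^0_i,\pi(O_i)))$; - the fact $performed(a,i,p)$ for each p-proposition "$A$ performed-at $I$ with-prob $P$". $\Pi_I$ consists of the following rules (";" in a body is disjunction): 1. $possVal(A,true)\leftarrow action(A)$ and $possVal(A,false)\leftarrow action(A)$ 2. $fluentOrAction(X)\leftarrow fluent(X);\ action(X)$ 3. $literal((X,V))\leftarrow possVal(X,V)$ 4. $iLiteral((L,I))\leftarrow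 literal(L),instant(I)$ 5. $definitelyPerformed(A,I)\leftarrow performed(A,I,1)$ 6. $possiblyPerformed(A,I)\leftarrow performed(A,I,P)$ 7. $1\{holds(((X,V),I)):iLiteral(((X,V),I))\}1\leftarrow instant(I),fluentOrAction(X)$ 8. $inOcc(I)\leftarrow instant(I),causesOutcome(O,I)$ 9. $1\{effectChoice(O,I):causesOutcome(O,I)\}1\leftarrow inOcc(I)$ 10. $1\{initialChoice(O):initialCondition(O)\}1$ 11. $\bot\leftarrow action(A),instant(I),holds(((A,true),I)),not\ possiblyPerformed(A,I)$ 12. $\bot\leftarrow action(A),instant(I),holds(((A,false),I)),definitelyPerformed(A,I)$ 13. $\bot\leftarrow initialChoice((S,P)),literal(L),belongsTo(L,S),not\ holds((L,0))$ 14. $\bot\leftarrow instant(I),effectChoice((X,P),I),fluent(F),belongsTo((F,V),X),not\ holds(((F,V),I+1)),I<maxinst$ 15. $\bot\leftarrow instant(I),fluent(F),not\ holds(((F,V),I)),effectChoice((X,P),I),not\ belongsTo((F,V),X),holds(((F,V),I+1)),I<maxinst$ 16. $\bot\leftarrow fluent(F),instant(I),holds(((F,V),I)),not\ inOcc(I),not\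 holds(((F,V),I+1)),I<maxinst$ 17. $eval(A,I,P)\leftarrow action(A),instant(I),performed(A,I,P),holds(((A,true),I))$ 18. $eval(A,I,1-P)\leftarrow action(A),instant(I),performed(A,I,P),holds(((A,false),I))$ Rules with variables stand for all their ground instances, and answer sets are stable models with the usual semantics of choice rules with conditional literals and cardinality bounds. **Trace of an answer set.** Let $Z$ be an answer set, $O=(\tilde X,P)$ an outcome and $I$ an instant. The choice element $O@I$ is manifest in $Z$ if there is a symbol $id$ such that $effectChoice((id,p),i)\in Z$ and, for every literal $X=V$, $(X=V)\in\tilde X$ iff $belongsTo((x,v),id)\in Z$; the element $O@\ast$ is manifest in $Z$ if the same holds with $initialChoice((id,p))\in Z$ in place of $effectChoice((id,p),i)\in Z$. A candidate trace $tr$ is the trace of $Z$ if its elements $tr(\ast)@\ast$ and $tr(I)@I$, $I\in dom(tr)$, are exactly the choice elements manifest in $Z$. **Proposition.** For every $maxinst\in\mathbb N$, every domain language and domain description $\mathcal D$ as above, every admissible choice of enumerations and disjunctive normal forms in the translation, and every candidate trace $tr$: $tr$ is a trace of $\mathcal D$ if and only if there exists an answer set $Z_{tr}$ of $\Pi_{\mathcal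 D}\cup\Pi_I$ such that $tr$ is the trace of $Z_{tr}$. -/

import Mathlib

namespace PEC

universe u

/-! Syntax and semantics of the language, over a totally ordered set `I` of instants with least
element `⊥`. -/

/-- A domain language with `(I, ≤, ⊥)` as its instants: finite sets of fluents, actions and values,
two distinguished truth values, and for every fluent and action a nonempty set of values. -/
structure DomainLanguage (I : Type*) [LinearOrder I] [OrderBot I] where
  Fluent : Type u
  Action : Type u
  Value : Type u
  finite_fluent : Finite Fluent
  nonempty_fluent : Nonempty Fluent
  finite_action : Finite Action
  finite_value : Finite Value
  top : Value
  bot : Value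
  top_ne_bot : top ≠ bot
  vals : Fluent ⊕ Action → Set Value
  vals_nonempty : ∀ x, (vals x).Nonempty
  vals_action : ∀ a, vals (Sum.inr a) = {top, bot}

section Semantics

variable {I : Type*} [LinearOrder I] [OrderBot I]

/-- A literal `X = V`, with `X` a fluent or an action and `V ∈ vals X`. -/
structure Literal (L : DomainLanguage.{u} I) where
  symbol : L.Fluent ⊕ L.Action
  value : L.Value
  value_mem : value ∈ L.vals symbol

/-- The literal `A = ⊤`. -/
def Literal.performs {L : DomainLanguage.{u} I} (a : L.Action) : Literal L :=
  ⟨Sum.inr a, L.top, by rw [L.vals_action]; exact Set.mem_insert _ _⟩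

/-- Formulas: the closure of the literals under conjunction and negation. -/
inductive Formula (L : DomainLanguage.{u} I) where
  | lit (l : Literal L)
  | and (θ θ' : Formula L)
  | neg (θ : Formula L)

/-- Truth of a formula when literals are read as propositional variables, `v` being the set of
true ones. -/
def Formula.Holds {L : DomainLanguage.{u} I} (v : Set (Literal L)) : Formula L → Prop
  | .lit l => l ∈ v
  | .and θ θ' => θ.Holds v ∧ θ'.Holds v
  | .neg θ => ¬ θ.Holds v

/-- Every Herbrand model of `θ` (literals taken as propositions) is a Herbrand model of `θ'`. -/
def Formula.HerbrandEntails {L : DomainLanguage.{u} I} (θ θ' : Formula L) : Prop :=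
  ∀ v : Set (Literal L), θ.Holds v → θ'.Holds v

/-- i-formulas: the closure of the i-literals `[l]@i` under conjunction and negation. -/
inductive IFormula (L : DomainLanguage.{u} I) where
  | lit (l : Literal L) (i : I)
  | and (φ φ' : IFormula L)
  | neg (φ : IFormula L)

/-- The i-formula `[θ]@i`. -/
def Formula.atInstant {L : DomainLanguage.{u} I} (i : I) : Formula L → IFormula L
  | .lit l => .lit l i
  | .and θ θ' => .and (θ.atInstant i) (θ'.atInstant i)
  | .neg θ => .neg (θ.atInstant i)

/-- States: sets of literals, exactly one for each fluent and each action. -/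
def states (L : DomainLanguage.{u} I) : Set (Set (Literal L)) :=
  {S | ∀ x, ∃! l, l ∈ S ∧ l.symbol = x}

/-- Partial states: subsets of states. -/
def partialStates (L : DomainLanguage.{u} I) : Set (Set (Literal L)) :=
  {X | ∃ S ∈ states L, X ⊆ S}

/-- The set of all fluent literals in `X`. -/
def fluentPart {L : DomainLanguage.{u} I} (X : Set (Literal L)) : Set (Literal L) :=
  {l ∈ X | ∃ f, l.symbol = Sum.inl f}

def fluentStates (L : DomainLanguage.{u} I) : Set (Set (Literal L)) := fluentPart '' states L

def partialFluentStates (L : DomainLanguage.{u} I) : Set (Set (Literal L)) :=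
  fluentPart '' partialStates L

/-- An outcome `(X, P)`: a partial fluent state and a probability in `(0, 1]`. -/
structure Outcome (L : DomainLanguage.{u} I) where
  eff : Set (Literal L)
  eff_mem : eff ∈ partialFluentStates L
  prob : ℝ
  prob_mem : prob ∈ Set.Ioc (0 : ℝ) 1

/-- `F takes-values {V₁, …, Vₘ}` -/
structure VProp (L : DomainLanguage.{u} I) where
  fluent : L.Fluent
  values : Set L.Value
  values_eq : values = L.vals (Sum.inl fluent)

/-- `θ causes-one-of {O₁, …, Oₘ}` -/
structure CProp (L : DomainLanguage.{u} I) where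
  body : Formula L
  head : Finset (Outcome L)
  eff_injOn : ∀ O ∈ head, ∀ O' ∈ head, O.eff = O'.eff → O = O'
  entails_action : ∃ a, body.HerbrandEntails (.lit (Literal.performs a))
  weight_eq_one : ∑ O ∈ head, O.prob = 1

/-- `initially-one-of {O₁, …, Oₘ}` -/
structure IProp (L : DomainLanguage.{u} I) where
  head : Finset (Outcome L)
  eff_injOn : ∀ O ∈ head, ∀ O' ∈ head, O.eff = O'.eff → O = O'
  eff_mem : ∀ O ∈ head, O.eff ∈ fluentStates L
  weight_eq_one : ∑ O ∈ head, O.prob = 1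

/-- `A performed-at i with-prob P`, where `i` is not the last instant. -/
structure PProp (L : DomainLanguage.{u} I) where
  action : L.Action
  inst : I
  prob : ℝ
  prob_mem : prob ∈ Set.Ioc (0 : ℝ) 1
  inst_lt : ∃ j, inst < j

/-- A domain description: a finite set of v-, c-, i- and p-propositions. -/
structure DomainDescription (L : DomainLanguage.{u} I) where
  vprops : Finset (VProp L)
  cprops : Finset (CProp L)
  iprops : Finset (IProp L)
  pprops : Finset (PProp L)
  not_entails : ∀ c ∈ cprops, ∀ c' ∈ cprops, c ≠ c' → ¬ c.body.HerbrandEntails c'.body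
  unique_iprop : ∃! j, j ∈ iprops
  unique_vprop : ∀ f, ∃! v, v ∈ vprops ∧ v.fluent = f
  unique_pprop : ∀ p ∈ pprops, ∀ p' ∈ pprops,
    p.action = p'.action → p.inst = p'.inst → p = p'

/-- A world: a function from instants to states. -/
def World (L : DomainLanguage.{u} I) := I → states L

/-- The set of literals that are true in `W` at `i`. -/
def World.state {L : DomainLanguage.{u} I} (W : World L) (i : I) : Set (Literal L) := (W i).1

/-- Satisfaction of an i-formula in a world. -/
def World.Sat {L : DomainLanguage.{u} I} (W : World L) : IFormula L → Prop
  | .lit l i => l ∈ W.state i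
  | .and φ φ' => W.Sat φ ∧ W.Sat φ'
  | .neg φ => ¬ W.Sat φ

/-- The update of a fluent state `S` by a partial fluent state `X`. -/
def update {L : DomainLanguage.{u} I} (S X : Set (Literal L)) : Set (Literal L) :=
  {l ∈ S | ¬ ∃ l' ∈ X, l'.symbol = l.symbol} ∪ X

namespace DomainDescription

variable {L : DomainLanguage.{u} I} (D : DomainDescription L)

/-- The closed world assumption for actions. -/
def CWA (W : World L) : Prop :=
  (∀ a i, W.Sat (.lit (Literal.performs a) i) → ∃ p ∈ D.pprops, p.action = a ∧ p.inst = i) ∧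
  ∀ p ∈ D.pprops, p.prob = 1 → W.Sat (.lit (Literal.performs p.action) p.inst)

/-- The c-proposition `c` of `D` is activated at `i` in `W`. -/
def Activated (W : World L) (i : I) (c : CProp L) : Prop :=
  c ∈ D.cprops ∧ W.Sat (c.body.atInstant i)

/-- The instants at which a cause occurs in `W`. -/
def occ (W : World L) : Set I := {i | ∃ c, D.Activated W i c}

/-- An initial choice: an outcome of the i-proposition of `D`. -/
def IsInitialChoice (ic : Outcome L) : Prop := ∃ j ∈ D.iprops, ic ∈ j.head

/-- An effect choice for `W`: it assigns to every instant at which a cause occurs an outcome of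
a c-proposition activated there (of the activated c-proposition, when only one is). -/
def IsEffectChoice (W : World L) (ec : D.occ W → Outcome L) : Prop :=
  ∀ i : D.occ W, ∃ c, D.Activated W i c ∧ ec i ∈ c.head

/-- `W` and the initial choice `ic` are consistent with each other. -/
def InitConsistent (W : World L) (ic : Outcome L) : Prop :=
  D.IsInitialChoice ic ∧ fluentPart (W.state ⊥) = ic.eff

/-- `W` and the effect choice `ec` are consistent with each other: whenever `i < i'`, the set
`occ W ∩ [i, i')` consists of finitely many instants `J₁ < … < Jₙ`, and updating the fluent state
at `i` with the effects of `ec J₁, …, ec Jₙ` in this order gives the fluent state at `i'`. -/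
def EffectConsistent (W : World L) (ec : D.occ W → Outcome L) : Prop :=
  D.IsEffectChoice W ec ∧ ∀ i i' : I, i < i' →
    ∃ l : List (D.occ W), l.Pairwise (· < ·) ∧
      (∀ j : D.occ W, j ∈ l ↔ i ≤ j.1 ∧ j.1 < i') ∧
      fluentPart (W.state i') = l.foldl (fun S j => update S (ec j).eff) (fluentPart (W.state i))

def InitialCondition (W : World L) : Prop := ∃ ic, D.InitConsistent W ic

def JustifiedChange (W : World L) : Prop := ∃ ec, D.EffectConsistent W ec

def WellBehaved (W : World L) : Prop := D.CWA W ∧ D.InitialCondition W ∧ D.JustifiedChange W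

end DomainDescription

/-- A candidate trace: an outcome attached to the extra initial symbol, and a partial function
from instants to outcomes. -/
structure CandidateTrace (L : DomainLanguage.{u} I) where
  initial : Outcome L
  outcomeAt : I → Option (Outcome L)

def CandidateTrace.dom {L : DomainLanguage.{u} I} (tr : CandidateTrace L) : Set I :=
  {i | ∃ O, tr.outcomeAt i = some O}

namespace DomainDescription

variable {L : DomainLanguage.{u} I} (D : DomainDescription L)

/-- `tr` is a trace of the world `W`. -/
def IsTraceOfWorld (W : World L) (tr : CandidateTrace L) : Prop :=
  D.WellBehaved W ∧ ∃ (ic : Outcome L) (ec : D.occ W → Outcome L),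
    D.InitConsistent W ic ∧ D.EffectConsistent W ec ∧
    tr.dom = D.occ W ∧ tr.initial = ic ∧ ∀ i : D.occ W, tr.outcomeAt i = some (ec i)

/-- `tr` is a trace of the domain description `D`. -/
def IsTrace (tr : CandidateTrace L) : Prop := ∃ W, D.WellBehaved W ∧ D.IsTraceOfWorld W tr

end DomainDescription

end Semantics

/-! Ground answer set programs with choice rules. -/

/-- Rule bodies over a set of ground atoms; `naf a` is the default negation of `a`. -/
inductive Body (α : Type*) where
  | tt
  | ff
  | pos (a : α)
  | naf (a : α)
  | and (b b' : Body α)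
  | or (b b' : Body α)

def Body.all {α : Type*} (l : List (Body α)) : Body α := l.foldr Body.and Body.tt

def Body.any {α : Type*} (l : List (Body α)) : Body α := l.foldr Body.or Body.ff

/-- Truth in `Y` of the reduct of the body with respect to `Z`: default negations are evaluated
in `Z`, all other atoms in `Y`. -/
def Body.Holds {α : Type*} (Z Y : Set α) : Body α → Prop
  | .tt => True
  | .ff => False
  | .pos a => a ∈ Y
  | .naf a => a ∉ Z
  | .and b b' => b.Holds Z Y ∧ b'.Holds Z Y
  | .or b b' => b.Holds Z Y ∨ b'.Holds Z Y

/-- Rule heads: an atom, `⊥` (for constraints), or a choice `lo {a₁ : c₁; a₂ : c₂; …} hi`, given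
by the set of its conditional literals `(aₖ, cₖ)`. -/
inductive Head (α : Type*) where
  | atom (a : α)
  | falsum
  | choice (lo hi : ℕ) (elems : Set (α × α))

structure Rule (α : Type*) where
  head : Head α
  body : Body α

/-- The fact `a.` -/
def Rule.fact {α : Type*} (a : α) : Rule α := ⟨.atom a, .tt⟩

/-- `Z` satisfies the head; for a choice, the number of its atoms that are in `Z` and whose
condition is in `Z` lies within the bounds. -/
def Head.Sat {α : Type*} (Z : Set α) : Head α → Prop
  | .atom a => a ∈ Z
  | .falsum => False
  | .choice lo hi elems =>
      (lo : ℕ∞) ≤ {a | a ∈ Z ∧ ∃ c ∈ Z, (a, c) ∈ elems}.encard ∧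
        {a | a ∈ Z ∧ ∃ c ∈ Z, (a, c) ∈ elems}.encard ≤ hi

/-- `Y` satisfies the reduct of the head with respect to `Z`; a choice becomes the family of the
atoms it offers that were chosen in `Z`, each subject to its condition. -/
def Head.SatReduct {α : Type*} (Z Y : Set α) : Head α → Prop
  | .atom a => a ∈ Y
  | .falsum => False
  | .choice _ _ elems => ∀ a c, (a, c) ∈ elems → a ∈ Z → c ∈ Y → a ∈ Y

/-- `Z` is an answer set (stable model) of the ground program `Pi`: it satisfies every rule, and no
proper subset of `Z` satisfies the reduct of `Pi` with respect to `Z`. -/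
def IsAnswerSet {α : Type*} (Pi : Set (Rule α)) (Z : Set α) : Prop :=
  (∀ r ∈ Pi, r.body.Holds Z Z → r.head.Sat Z) ∧
  ∀ Y ⊆ Z, (∀ r ∈ Pi, r.body.Holds Z Y → r.head.SatReduct Z Y) → Y = Z

/-! The translation, for the instants `0, …, maxinst`. -/

section Translation

variable {maxinst : ℕ}

/-- Ground terms: constants for fluents, actions and values, numerals, the constants `id n i`
naming outcomes, and pairs. -/
inductive Term (L : DomainLanguage.{u} (Fin (maxinst + 1))) where
  | fluent (f : L.Fluent)
  | action (a : L.Action)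
  | value (v : L.Value)
  | num (r : ℝ)
  | id (n i : ℕ)
  | pair (s t : Term L)

/-- Ground atoms. -/
inductive Atom (L : DomainLanguage.{u} (Fin (maxinst + 1))) where
  | fluent (x : Term L)
  | action (x : Term L)
  | instant (i : Term L)
  | possVal (x v : Term L)
  | fluentOrAction (x : Term L)
  | literal (l : Term L)
  | iLiteral (l : Term L)
  | belongsTo (l s : Term L)
  | causesOutcome (o i : Term L)
  | initialCondition (o : Term L)
  | performed (a i p : Term L)
  | definitelyPerformed (a i : Term L)
  | possiblyPerformed (a i : Term L)
  | holds (l : Term L)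
  | inOcc (i : Term L)
  | effectChoice (o i : Term L)
  | initialChoice (o : Term L)
  | eval (a i p : Term L)

variable {L : DomainLanguage.{u} (Fin (maxinst + 1))}

/-- The numeral of an instant. -/
def Term.inst (i : Fin (maxinst + 1)) : Term L := .num (i : ℕ)

def Term.symbol : L.Fluent ⊕ L.Action → Term L
  | .inl f => .fluent f
  | .inr a => .action a

/-- The literal `X = V` is translated to the pair `(x, v)`. -/
def Term.ofLiteral (l : Literal L) : Term L := .pair (Term.symbol l.symbol) (.value l.value)

/-- The list `l` enumerates the finite set `s` without repetitions. -/
def IsEnumeration {β : Type*} (l : List β) (s : Finset β) : Prop := l.Nodup ∧ ∀ x, x ∈ l ↔ x ∈ s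

/-- `d` is a disjunctive normal form of `θ`: a list (disjunction) of lists (conjunctions) of
literals that has the same truth value as `θ` in every state. -/
def IsDNF (d : List (List (Literal L))) (θ : Formula L) : Prop :=
  ∀ S ∈ states L, θ.Holds S ↔ ∃ conj ∈ d, ∀ l ∈ conj, l ∈ S

/-- The choices that the translation of `D` leaves open: enumerations of the c-propositions and of
the outcomes of the c- and i-propositions, and disjunctive normal forms of the bodies. -/
structure TranslationChoice (D : DomainDescription L) where
  cList : List (CProp L)
  cList_enum : IsEnumeration cList D.cprops
  cOutcomes : CProp L → List (Outcome L)
  cOutcomes_enum : ∀ c ∈ D.cprops, IsEnumeration (cOutcomes c) c.head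
  iOutcomes : IProp L → List (Outcome L)
  iOutcomes_enum : ∀ j ∈ D.iprops, IsEnumeration (iOutcomes j) j.head
  dnf : CProp L → List (List (Literal L))
  dnf_isDNF : ∀ c ∈ D.cprops, IsDNF (dnf c) c.body

/-- The body `holds([θ₁]@I); …; holds([θₙ]@I)` for a disjunctive normal form `θ₁ ∨ … ∨ θₙ`. -/
def holdsBody (d : List (List (Literal L))) (t : Term L) : Body (Atom L) :=
  Body.any (d.map fun conj =>
    Body.all (conj.map fun l => Body.pos (.holds (.pair (Term.ofLiteral l) t))))

/-- The facts for the three sorts. -/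
def sortRules (L : DomainLanguage.{u} (Fin (maxinst + 1))) : Set (Rule (Atom L)) :=
  {r | ∃ f, r = .fact (.fluent (.fluent f))} ∪
  {r | ∃ a, r = .fact (.action (.action a))} ∪
  {r | ∃ i : Fin (maxinst + 1), r = .fact (.instant (Term.inst i))}

/-- The translated v-propositions. -/
def vRules (D : DomainDescription L) : Set (Rule (Atom L)) :=
  {r | ∃ p ∈ D.vprops, ∃ v ∈ p.values, r = .fact (.possVal (.fluent p.fluent) (.value v))}

/-- The translated c-propositions. The `n`-th c-proposition (counted from `1`) has its `i`-th
outcome (counted from `1`) named `id n i`. -/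
def cRules {D : DomainDescription L} (T : TranslationChoice D) : Set (Rule (Atom L)) :=
  {r | ∃ n c, T.cList[n]? = some c ∧ ∃ i O, (T.cOutcomes c)[i]? = some O ∧
    ∃ l ∈ O.eff, r = .fact (.belongsTo (Term.ofLiteral l) (.id (n + 1) (i + 1)))} ∪
  {r | ∃ n c, T.cList[n]? = some c ∧ ∃ i O, (T.cOutcomes c)[i]? = some O ∧
    ∃ t : Term L, r = ⟨.atom (.causesOutcome (.pair (.id (n + 1) (i + 1)) (.num O.prob)) t),
      holdsBody (T.dnf c) t⟩}

/-- The translated i-proposition. Its `i`-th outcome (counted from `1`) is named `id 0 i`. -/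
def iRules {D : DomainDescription L} (T : TranslationChoice D) : Set (Rule (Atom L)) :=
  {r | ∃ j ∈ D.iprops, ∃ i O, (T.iOutcomes j)[i]? = some O ∧
    ∃ l ∈ O.eff, r = .fact (.belongsTo (Term.ofLiteral l) (.id 0 (i + 1)))} ∪
  {r | ∃ j ∈ D.iprops, ∃ i O, (T.iOutcomes j)[i]? = some O ∧
    r = .fact (.initialCondition (.pair (.id 0 (i + 1)) (.num O.prob)))}

/-- The translated p-propositions. -/
def pRules (D : DomainDescription L) : Set (Rule (Atom L)) :=
  {r | ∃ p ∈ D.pprops,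
    r = .fact (.performed (.action p.action) (Term.inst p.inst) (.num p.prob))}

/-- The domain-dependent program. -/
def domainProgram {D : DomainDescription L} (T : TranslationChoice D) : Set (Rule (Atom L)) :=
  sortRules L ∪ vRules D ∪ cRules T ∪ iRules T ∪ pRules D

/-- The ground instances of the domain-independent axioms, variables ranging over all ground terms.
Arithmetic is evaluated during grounding: `I + 1` and `1 - P` are defined for numerals only, and
the instances with a false comparison `I < maxinst` are dropped. -/
inductive AxiomInstance (L : DomainLanguage.{u} (Fin (maxinst + 1))) : Rule (Atom L) → Prop
  | pec1_true (a : Term L) : AxiomInstance L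
      ⟨.atom (.possVal a (.value L.top)), .pos (.action a)⟩
  | pec1_false (a : Term L) : AxiomInstance L
      ⟨.atom (.possVal a (.value L.bot)), .pos (.action a)⟩
  | pec2 (x : Term L) : AxiomInstance L
      ⟨.atom (.fluentOrAction x), .or (.pos (.fluent x)) (.pos (.action x))⟩
  | pec3 (x v : Term L) : AxiomInstance L
      ⟨.atom (.literal (.pair x v)), .pos (.possVal x v)⟩
  | pec4 (l i : Term L) : AxiomInstance L
      ⟨.atom (.iLiteral (.pair l i)), .and (.pos (.literal l)) (.pos (.instant i))⟩
  | pec5 (a i : Term L) : AxiomInstance L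
      ⟨.atom (.definitelyPerformed a i), .pos (.performed a i (.num 1))⟩
  | pec6 (a i p : Term L) : AxiomInstance L
      ⟨.atom (.possiblyPerformed a i), .pos (.performed a i p)⟩
  | pec7 (x i : Term L) : AxiomInstance L
      ⟨.choice 1 1 {e | ∃ v : Term L,
          e = (.holds (.pair (.pair x v) i), .iLiteral (.pair (.pair x v) i))},
        .and (.pos (.instant i)) (.pos (.fluentOrAction x))⟩
  | pec8 (o i : Term L) : AxiomInstance L
      ⟨.atom (.inOcc i), .and (.pos (.instant i)) (.pos (.causesOutcome o i))⟩
  | pec9 (i : Term L) : AxiomInstance L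
      ⟨.choice 1 1 {e | ∃ o : Term L, e = (.effectChoice o i, .causesOutcome o i)},
        .pos (.inOcc i)⟩
  | pec10 : AxiomInstance L
      ⟨.choice 1 1 {e | ∃ o : Term L, e = (.initialChoice o, .initialCondition o)}, .tt⟩
  | pec11 (a i : Term L) : AxiomInstance L
      ⟨.falsum, Body.all [.pos (.action a), .pos (.instant i),
        .pos (.holds (.pair (.pair a (.value L.top)) i)), .naf (.possiblyPerformed a i)]⟩
  | pec12 (a i : Term L) : AxiomInstance L
      ⟨.falsum, Body.all [.pos (.action a), .pos (.instant i),
        .pos (.holds (.pair (.pair a (.value L.bot)) i)), .pos (.definitelyPerformed a i)]⟩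
  | pec13 (s p l : Term L) : AxiomInstance L
      ⟨.falsum, Body.all [.pos (.initialChoice (.pair s p)), .pos (.literal l),
        .pos (.belongsTo l s), .naf (.holds (.pair l (.num 0)))]⟩
  | pec14 (i : ℝ) (x p f v : Term L) (hi : i < maxinst) : AxiomInstance L
      ⟨.falsum, Body.all [.pos (.instant (.num i)), .pos (.effectChoice (.pair x p) (.num i)),
        .pos (.fluent f), .pos (.belongsTo (.pair f v) x),
        .naf (.holds (.pair (.pair f v) (.num (i + 1))))]⟩
  | pec15 (i : ℝ) (x p f v : Term L) (hi : i < maxinst) : AxiomInstance L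
      ⟨.falsum, Body.all [.pos (.instant (.num i)), .pos (.fluent f),
        .naf (.holds (.pair (.pair f v) (.num i))), .pos (.effectChoice (.pair x p) (.num i)),
        .naf (.belongsTo (.pair f v) x), .pos (.holds (.pair (.pair f v) (.num (i + 1))))]⟩
  | pec16 (i : ℝ) (f v : Term L) (hi : i < maxinst) : AxiomInstance L
      ⟨.falsum, Body.all [.pos (.fluent f), .pos (.instant (.num i)),
        .pos (.holds (.pair (.pair f v) (.num i))), .naf (.inOcc (.num i)),
        .naf (.holds (.pair (.pair f v) (.num (i + 1))))]⟩
  | pec17 (a i p : Term L) : AxiomInstance L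
      ⟨.atom (.eval a i p), Body.all [.pos (.action a), .pos (.instant i),
        .pos (.performed a i p), .pos (.holds (.pair (.pair a (.value L.top)) i))]⟩
  | pec18 (a i : Term L) (p : ℝ) : AxiomInstance L
      ⟨.atom (.eval a i (.num (1 - p))), Body.all [.pos (.action a), .pos (.instant i),
        .pos (.performed a i (.num p)), .pos (.holds (.pair (.pair a (.value L.bot)) i))]⟩

/-- The domain-independent program. -/
def independentProgram (L : DomainLanguage.{u} (Fin (maxinst + 1))) : Set (Rule (Atom L)) :=
  {r | AxiomInstance L r}

/-- In `Z`, the literals that belong to `s` are exactly those in the effect of `O`. -/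
def Represents (Z : Set (Atom L)) (s : Term L) (O : Outcome L) : Prop :=
  ∀ l : Literal L, l ∈ O.eff ↔ Atom.belongsTo (Term.ofLiteral l) s ∈ Z

/-- The choice element `O@i` is manifest in `Z`. -/
def Manifest (Z : Set (Atom L)) (O : Outcome L) (i : Fin (maxinst + 1)) : Prop :=
  ∃ s : Term L, Atom.effectChoice (.pair s (.num O.prob)) (Term.inst i) ∈ Z ∧ Represents Z s O

/-- The choice element attaching `O` to the initial symbol is manifest in `Z`. -/
def ManifestInitial (Z : Set (Atom L)) (O : Outcome L) : Prop :=
  ∃ s : Term L, Atom.initialChoice (.pair s (.num O.prob)) ∈ Z ∧ Represents Z s O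

/-- The elements of `tr` are exactly the choice elements that are manifest in `Z`. -/
def IsTraceOfAnswerSet (Z : Set (Atom L)) (tr : CandidateTrace L) : Prop :=
  (∀ O, tr.initial = O ↔ ManifestInitial Z O) ∧
  ∀ i O, tr.outcomeAt i = some O ↔ Manifest Z O i

end Translation

end PEC

/-!
The program splits into layers: the sorts, literals and outcome names are facts, the atoms `holds`
guess a world, `causesOutcome` and `inOcc` read off where causes occur in it, and `effectChoice` and
`initialChoice` guess the outcomes. Since no atom depends on itself, a set of atoms is an answer set
exactly if it satisfies all rules and each of its atoms is derived by some rule.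

From an answer set to a trace: every atom of an answer set is derived by a rule
(`IsAnswerSet.exists_offers`), which gives the needed half of the Clark completion of the program
(`IsAnswerSet.explained`). Hence the `holds` atoms form a world (`IsAnswerSet.world`), with one
outcome chosen initially and one at each instant at which a cause occurs. The constraints on the
performed actions are the closed world assumption, the one on the initial choice is consistency
with it, and the last three are a literal-by-literal description of the update from one
instant to the next (`fluentPart_eq_update_iff`, `fluentPart_eq_iff`). Consistency with an effect
choice over arbitrary intervals reduces to these single steps
(`DomainDescription.effectConsistent_iff`).

From a trace to an answer set: `canonicalSet` collects the atoms that a world with its choices makes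
true. It satisfies all rules (`canonicalSet_sat`), and going up through the layers shows that it is
contained in every model of the reduct (`canonicalSet_subset_of_reduct`).

A choice element is manifest through a constant naming an outcome; such a constant determines the
outcome (`Names.unique`), and the program makes exactly the literals in its effect belong to it. So
the manifest elements are the chosen outcomes.
-/

namespace PEC

universe u

/-! ### Supportedness of answer sets -/

section AnswerSets

variable {α : Type*}

theorem Body.Holds.mono {Z Y Y' : Set α} (h : Y ⊆ Y') {b : Body α} (hb : b.Holds Z Y) :
    b.Holds Z Y' := by
  induction b with
  | tt => trivial
  | ff => exact hb
  | pos a => exact h hb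
  | naf a => exact hb
  | and b b' ih ih' => exact ⟨ih hb.1, ih' hb.2⟩
  | or b b' ih ih' => exact hb.imp ih ih'

@[simp] theorem Body.holds_all {Z Y : Set α} {l : List (Body α)} :
    (Body.all l).Holds Z Y ↔ ∀ b ∈ l, b.Holds Z Y := by
  induction l with
  | nil => simp [Body.all, Body.Holds]
  | cons b l ih =>
    rw [List.forall_mem_cons, ← ih]
    rfl

@[simp] theorem Body.holds_any {Z Y : Set α} {l : List (Body α)} :
    (Body.any l).Holds Z Y ↔ ∃ b ∈ l, b.Holds Z Y := by
  induction l with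
  | nil => simp [Body.any, Body.Holds]
  | cons b l ih =>
    rw [List.exists_mem_cons_iff, ← ih]
    rfl

/-- The head can derive the atom `a`: it is `a` itself, or a choice offering `a` under a condition
that is true in `Z`. -/
def Head.Offers (Z : Set α) (a : α) : Head α → Prop
  | .atom b => b = a
  | .falsum => False
  | .choice _ _ elems => ∃ c ∈ Z, (a, c) ∈ elems

/-- Every atom of an answer set is derived by some rule: an underivable atom could be removed
without violating the reduct. -/
theorem IsAnswerSet.exists_offers {Pi : Set (Rule α)} {Z : Set α} (hZ : IsAnswerSet Pi Z)
    {a : α} (ha : a ∈ Z) : ∃ r ∈ Pi, r.body.Holds Z Z ∧ r.head.Offers Z a := by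
  by_contra! hno
  have hY : Z \ {a} = Z := by
    refine hZ.2 _ Set.sdiff_subset fun r hr hb => ?_
    have hbZ := hb.mono Set.sdiff_subset
    have hs := hZ.1 r hr hbZ
    have ho := hno r hr hbZ
    rcases r with ⟨_ | _ | ⟨lo, hi, elems⟩, b⟩
    · exact ⟨hs, ho⟩
    · exact hs
    · intro b c hbc hbZ' hc
      refine ⟨hbZ', ?_⟩
      rintro rfl
      exact ho ⟨c, hc.1, hbc⟩
  exact (hY.symm ▸ ha : a ∈ Z \ {a}).2 rfl

theorem Head.sat_choice_one_one {Z : Set α} {elems : Set (α × α)} :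
    (Head.choice 1 1 elems).Sat Z ↔ ∃! a, a ∈ Z ∧ ∃ c ∈ Z, (a, c) ∈ elems := by
  simp only [Head.Sat, Nat.cast_one, and_comm (a := (1 : ℕ∞) ≤ _), ← le_antisymm_iff,
    Set.encard_eq_one, Set.eq_singleton_iff_unique_mem]
  rfl

end AnswerSets

/-! ### States and updates -/

section States

variable {I : Type*} [LinearOrder I] [OrderBot I] {L : DomainLanguage.{u} I}

theorem Literal.ext' {l l' : Literal L} (h : l.symbol = l'.symbol) (h' : l.value = l'.value) :
    l = l' := by
  cases l; cases l'; cases h; cases h'; rfl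

theorem Outcome.ext' {O O' : Outcome L} (h : O.eff = O'.eff) (h' : O.prob = O'.prob) :
    O = O' := by
  cases O; cases O'; cases h; cases h'; rfl

theorem eq_of_mem_state {S : Set (Literal L)} (hS : S ∈ states L) {l l' : Literal L}
    (hl : l ∈ S) (hl' : l' ∈ S) (h : l.symbol = l'.symbol) : l = l' :=
  (hS l'.symbol).unique ⟨hl, h⟩ ⟨hl', rfl⟩

theorem exists_symbol_of_mem_partialFluentState {X : Set (Literal L)}
    (hX : X ∈ partialFluentStates L) {l : Literal L} (hl : l ∈ X) :
    ∃ f, l.symbol = Sum.inl f := by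
  obtain ⟨Y, -, rfl⟩ := hX
  exact hl.2

/-- The literal `A = ⊥`. -/
def Literal.omits (a : L.Action) : Literal L :=
  ⟨Sum.inr a, L.bot, by rw [L.vals_action]; exact Set.mem_insert_of_mem _ rfl⟩

theorem Literal.eq_performs_or_eq_omits {l : Literal L} {a : L.Action}
    (h : l.symbol = Sum.inr a) : l = .performs a ∨ l = .omits a := by
  have hv := l.value_mem
  rw [h, L.vals_action] at hv
  exact hv.imp (fun h' => Literal.ext' h h') (fun h' => Literal.ext' h h')

theorem omits_mem_iff {S : Set (Literal L)} (hS : S ∈ states L) (a : L.Action) :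
    Literal.omits a ∈ S ↔ Literal.performs a ∉ S := by
  refine ⟨fun h h' => L.top_ne_bot ?_, fun h => ?_⟩
  · exact congrArg Literal.value (eq_of_mem_state hS h' h rfl)
  · obtain ⟨l, ⟨hl, hs⟩, -⟩ := hS (Sum.inr a)
    obtain rfl | rfl := Literal.eq_performs_or_eq_omits hs
    · exact absurd hl h
    · exact hl

theorem fluentPart_eq_iff {S S' : Set (Literal L)} (hS : S ∈ states L) (hS' : S' ∈ states L) :
    fluentPart S' = fluentPart S ↔ ∀ l ∈ S, ∀ f, l.symbol = Sum.inl f → l ∈ S' := by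
  refine ⟨fun h l hl f hf => ?_, fun h => ?_⟩
  · have : l ∈ fluentPart S := ⟨hl, f, hf⟩
    exact (h ▸ this : l ∈ fluentPart S').1
  · ext l
    refine ⟨fun ⟨hl, f, hf⟩ => ⟨?_, f, hf⟩, fun ⟨hl, f, hf⟩ => ⟨h l hl f hf, f, hf⟩⟩
    obtain ⟨l', ⟨hl', hs⟩, -⟩ := hS (Sum.inl f)
    rwa [eq_of_mem_state hS' hl (h l' hl' f hs) (hf.trans hs.symm)]

/-- A fluent state updated by `X` is described by two conditions on single literals: those of `X`
hold afterwards, and no fluent literal becomes true unless it is in `X`. -/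
theorem fluentPart_eq_update_iff {S S' X : Set (Literal L)} (hS : S ∈ states L)
    (hS' : S' ∈ states L) (hX : X ∈ partialFluentStates L) :
    fluentPart S' = update (fluentPart S) X ↔
      (∀ l ∈ X, l ∈ S') ∧ ∀ l ∈ S', ∀ f, l.symbol = Sum.inl f → l ∉ X → l ∈ S := by
  constructor
  · intro h
    constructor
    · intro l hl
      have : l ∈ update (fluentPart S) X := Or.inr hl
      exact (h ▸ this : l ∈ fluentPart S').1
    · intro l hl f hf hlX
      have : l ∈ fluentPart S' := ⟨hl, f, hf⟩
      rw [h] at this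
      exact (this.resolve_right hlX).1.1
  · rintro ⟨h₁, h₂⟩
    ext l
    constructor
    · rintro ⟨hl, f, hf⟩
      by_cases hlX : l ∈ X
      · exact Or.inr hlX
      · refine Or.inl ⟨⟨h₂ l hl f hf hlX, f, hf⟩, ?_⟩
        rintro ⟨l', hl', hs⟩
        exact hlX (eq_of_mem_state hS' (h₁ l' hl') hl hs ▸ hl')
    · rintro (⟨⟨hl, f, hf⟩, hno⟩ | hl)
      · refine ⟨?_, f, hf⟩
        obtain ⟨l', ⟨hl', hs⟩, -⟩ := hS' (Sum.inl f)
        have hl'S : l' ∈ S := h₂ l' hl' f hs fun hX' => hno ⟨l', hX', hs.trans hf.symm⟩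
        rwa [eq_of_mem_state hS hl hl'S (hf.trans hs.symm)]
      · exact ⟨h₁ l hl, exists_symbol_of_mem_partialFluentState hX hl⟩

theorem World.state_mem (W : World L) (i : I) : W.state i ∈ states L := (W i).2

@[simp] theorem World.sat_atInstant (W : World L) (i : I) (θ : Formula L) :
    W.Sat (θ.atInstant i) ↔ θ.Holds (W.state i) := by
  induction θ with
  | lit l => rfl
  | and θ θ' ih ih' => exact and_congr ih ih'
  | neg θ ih => exact not_congr ih

theorem DomainDescription.activated_iff {D : DomainDescription L} {W : World L} {i : I}
    {c : CProp L} : D.Activated W i c ↔ c ∈ D.cprops ∧ c.body.Holds (W.state i) := by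
  rw [DomainDescription.Activated, World.sat_atInstant]

end States

section Steps

variable {maxinst : ℕ} {L : DomainLanguage.{u} (Fin (maxinst + 1))} {D : DomainDescription L}

/-- Consistency with an effect choice only has to be checked between consecutive instants. -/
theorem DomainDescription.effectConsistent_iff {W : World L} {ec : D.occ W → Outcome L} :
    D.EffectConsistent W ec ↔ D.IsEffectChoice W ec ∧
      ∀ i i' : Fin (maxinst + 1), (i : ℕ) + 1 = i' →
        (∀ h : i ∈ D.occ W,
          fluentPart (W.state i') = update (fluentPart (W.state i)) (ec ⟨i, h⟩).eff) ∧
        (i ∉ D.occ W → fluentPart (W.state i') = fluentPart (W.state i)) := by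
  refine and_congr_right fun _ => ⟨fun h i i' hi => ?_, fun h i i' hi => ?_⟩
  · obtain ⟨l, hl, hmem, heq⟩ := h i i' (by rw [Fin.lt_def]; omega)
    have hmem' : ∀ j : D.occ W, j ∈ l ↔ j.1 = i := by
      intro j
      rw [hmem, Fin.le_def, Fin.lt_def, Fin.ext_iff]
      omega
    refine ⟨fun hocc => ?_, fun hocc => ?_⟩
    · have : l = [⟨i, hocc⟩] := by
        rw [← List.perm_singleton]
        refine (List.perm_ext_iff_of_nodup (hl.imp fun h => h.ne) (List.nodup_singleton _)).2 ?_
        intro j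
        rw [hmem', List.mem_singleton, Subtype.ext_iff]
      rw [heq, this]
      rfl
    · have : l = [] := List.eq_nil_iff_forall_not_mem.2 fun j hj => hocc ((hmem' j).1 hj ▸ j.2)
      rw [heq, this]
      rfl
  -- Starting from the empty interval `[i, i)`, the interval is extended by one instant at a time.
  · suffices H : ∀ n : ℕ, ∀ k : Fin (maxinst + 1), (k : ℕ) = i + n →
        ∃ l : List (D.occ W), l.Pairwise (· < ·) ∧
          (∀ j : D.occ W, j ∈ l ↔ i ≤ j.1 ∧ j.1 < k) ∧
          fluentPart (W.state k) =
            l.foldl (fun S j => update S (ec j).eff) (fluentPart (W.state i)) by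
      rw [Fin.lt_def] at hi
      exact H (i' - i) i' (by omega)
    intro n
    induction n with
    | zero =>
      intro k hk
      obtain rfl : k = i := Fin.ext hk
      exact ⟨[], List.Pairwise.nil, fun j => by simp, rfl⟩
    | succ n ih =>
      intro k hk
      obtain ⟨l, hl, hmem, heq⟩ := ih ⟨i + n, by omega⟩ rfl
      have hstep := h ⟨i + n, by omega⟩ k (by simp only; omega)
      by_cases hocc : (⟨i + n, by omega⟩ : Fin (maxinst + 1)) ∈ D.occ W
      · refine ⟨l ++ [⟨_, hocc⟩], ?_, fun j => ?_, ?_⟩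
        · rw [List.pairwise_append]
          refine ⟨hl, List.pairwise_singleton _ _, fun a ha b hb => ?_⟩
          rw [List.mem_singleton.1 hb]
          exact ((hmem a).1 ha).2
        · rw [List.mem_append, hmem, List.mem_singleton, Subtype.ext_iff, Fin.ext_iff]
          simp only [Fin.le_def, Fin.lt_def]
          omega
        · rw [List.foldl_append, ← heq]
          exact hstep.1 hocc
      · refine ⟨l, hl, fun j => ?_, (hstep.2 hocc).trans heq⟩
        rw [hmem]
        have hne : j.1 ≠ ⟨i + n, by omega⟩ := fun h => hocc (h ▸ j.2)
        rw [Ne, Fin.ext_iff] at hne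
        simp only [Fin.le_def, Fin.lt_def] at hne ⊢
        omega

end Steps

/-! ### Atoms derived by the translation -/

section Translation

variable {maxinst : ℕ} {L : DomainLanguage.{u} (Fin (maxinst + 1))} {D : DomainDescription L}

theorem Term.inst_injective : Function.Injective (Term.inst (L := L)) := fun i j h => by
  simpa [Term.inst, Fin.ext_iff] using h

theorem Term.symbol_injective : Function.Injective (Term.symbol (L := L)) := by
  rintro (f | a) (f' | a') h <;> simp_all [Term.symbol]

theorem Term.ofLiteral_injective : Function.Injective (Term.ofLiteral (L := L)) := by
  intro l l' h
  simp only [Term.ofLiteral, Term.pair.injEq, Term.value.injEq] at h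
  exact Literal.ext' (Term.symbol_injective h.1) h.2

theorem Term.num_eq_inst_zero : (Term.num 0 : Term L) = Term.inst ⊥ := by
  simp [Term.inst, bot_eq_zero]

/-- The term `s` is the constant naming the outcome `O` of the c-proposition `c`. -/
def NamesEffect (T : TranslationChoice D) (c : CProp L) (s : Term L) (O : Outcome L) : Prop :=
  ∃ n i, T.cList[n]? = some c ∧ (T.cOutcomes c)[i]? = some O ∧ s = .id (n + 1) (i + 1)

/-- The term `s` is the constant naming the outcome `O` of the i-proposition. -/
def NamesInitial (T : TranslationChoice D) (s : Term L) (O : Outcome L) : Prop :=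
  ∃ j ∈ D.iprops, ∃ i, (T.iOutcomes j)[i]? = some O ∧ s = .id 0 (i + 1)

/-- The term `s` is the constant naming the outcome `O`. -/
def Names (T : TranslationChoice D) (s : Term L) (O : Outcome L) : Prop :=
  (∃ c, NamesEffect T c s O) ∨ NamesInitial T s O

variable {T : TranslationChoice D}

theorem NamesEffect.mem {c : CProp L} {s : Term L} {O : Outcome L} (h : NamesEffect T c s O) :
    c ∈ D.cprops ∧ O ∈ c.head := by
  obtain ⟨n, i, hc, hO, -⟩ := h
  have hcD := (T.cList_enum.2 c).1 (List.mem_of_getElem? hc)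
  exact ⟨hcD, ((T.cOutcomes_enum c hcD).2 O).1 (List.mem_of_getElem? hO)⟩

theorem exists_namesEffect (T : TranslationChoice D) {c : CProp L} (hc : c ∈ D.cprops)
    {O : Outcome L} (hO : O ∈ c.head) : ∃ s, NamesEffect T c s O := by
  obtain ⟨n, hn⟩ := List.mem_iff_getElem?.1 ((T.cList_enum.2 c).2 hc)
  obtain ⟨i, hi⟩ := List.mem_iff_getElem?.1 (((T.cOutcomes_enum c hc).2 O).2 hO)
  exact ⟨_, n, i, hn, hi, rfl⟩

theorem NamesInitial.isInitialChoice {s : Term L} {O : Outcome L} (h : NamesInitial T s O) :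
    D.IsInitialChoice O := by
  obtain ⟨j, hj, i, hO, -⟩ := h
  exact ⟨j, hj, ((T.iOutcomes_enum j hj).2 O).1 (List.mem_of_getElem? hO)⟩

theorem exists_namesInitial (T : TranslationChoice D) {O : Outcome L}
    (hO : D.IsInitialChoice O) : ∃ s, NamesInitial T s O := by
  obtain ⟨j, hj, hO⟩ := hO
  obtain ⟨i, hi⟩ := List.mem_iff_getElem?.1 (((T.iOutcomes_enum j hj).2 O).2 hO)
  exact ⟨_, j, hj, i, hi, rfl⟩

theorem Names.unique {s : Term L} {O O' : Outcome L} (h : Names T s O) (h' : Names T s O') :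
    O = O' := by
  rcases h with ⟨c, n, i, hc, hO, rfl⟩ | ⟨j, hj, i, hO, rfl⟩ <;>
    rcases h' with ⟨c', n', i', hc', hO', h⟩ | ⟨j', hj', i', hO', h⟩
  · simp only [Term.id.injEq, Nat.add_right_cancel_iff] at h
    obtain ⟨rfl, rfl⟩ := h
    obtain rfl : c = c' := Option.some_injective _ (hc.symm.trans hc')
    exact Option.some_injective _ (hO.symm.trans hO')
  · simp at h
  · simp at h
  · simp only [Term.id.injEq, Nat.add_right_cancel_iff, true_and] at h
    obtain rfl := h
    obtain rfl := D.unique_iprop.unique hj hj'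
    exact Option.some_injective _ (hO.symm.trans hO')

/-- The whole program. -/
abbrev program (T : TranslationChoice D) : Set (Rule (Atom L)) :=
  domainProgram T ∪ independentProgram L

theorem holdsBody_holds {Z Y : Set (Atom L)} {d : List (List (Literal L))} {t : Term L} :
    (holdsBody d t).Holds Z Y ↔
      ∃ conj ∈ d, ∀ l ∈ conj, Atom.holds (.pair (Term.ofLiteral l) t) ∈ Y := by
  simp [holdsBody, Body.Holds]

/-- `Y` is closed under the rules of the program with an atom as head, default negation being
evaluated in `Z`. Both an answer set `Z` (with `Y = Z`) and every model `Y` of the reduct with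
respect to `Z` have this property. -/
def Closed (T : TranslationChoice D) (Z Y : Set (Atom L)) : Prop :=
  ∀ (a : Atom L) (b : Body (Atom L)), ⟨.atom a, b⟩ ∈ program T → b.Holds Z Y → a ∈ Y

namespace Closed

variable {Z Y : Set (Atom L)} (hY : Closed T Z Y)

include hY

theorem fluent (f : L.Fluent) : Atom.fluent (.fluent f) ∈ Y :=
  hY _ .tt (.inl (.inl (.inl (.inl (.inl (.inl (.inl ⟨f, rfl⟩))))))) trivial

theorem action (a : L.Action) : Atom.action (.action a) ∈ Y :=
  hY _ .tt (.inl (.inl (.inl (.inl (.inl (.inl (.inr ⟨a, rfl⟩))))))) trivial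

theorem instant (i : Fin (maxinst + 1)) : Atom.instant (Term.inst i) ∈ Y :=
  hY _ .tt (.inl (.inl (.inl (.inl (.inl (.inr ⟨i, rfl⟩)))))) trivial

theorem belongsTo {s : Term L} {O : Outcome L} (hO : Names T s O) {l : Literal L}
    (hl : l ∈ O.eff) : Atom.belongsTo (Term.ofLiteral l) s ∈ Y := by
  rcases hO with ⟨c, n, i, hc, hO, rfl⟩ | ⟨j, hj, i, hO, rfl⟩
  · exact hY _ .tt (.inl (.inl (.inl (.inr (.inl ⟨n, c, hc, i, O, hO, l, hl, rfl⟩))))) trivial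
  · exact hY _ .tt (.inl (.inl (.inr (.inl ⟨j, hj, i, O, hO, l, hl, rfl⟩)))) trivial

theorem causesOutcome {c : CProp L} {s : Term L} {O : Outcome L} (hO : NamesEffect T c s O)
    {t : Term L}
    (ht : ∃ conj ∈ T.dnf c, ∀ l ∈ conj, Atom.holds (.pair (Term.ofLiteral l) t) ∈ Y) :
    Atom.causesOutcome (.pair s (.num O.prob)) t ∈ Y := by
  obtain ⟨n, i, hc, hO, rfl⟩ := hO
  exact hY _ _ (.inl (.inl (.inl (.inr (.inr ⟨n, c, hc, i, O, hO, t, rfl⟩)))))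
    (holdsBody_holds.2 ht)

theorem initialCondition {s : Term L} {O : Outcome L} (hO : NamesInitial T s O) :
    Atom.initialCondition (.pair s (.num O.prob)) ∈ Y := by
  obtain ⟨j, hj, i, hO, rfl⟩ := hO
  exact hY _ .tt (.inl (.inl (.inr (.inr ⟨j, hj, i, O, hO, rfl⟩)))) trivial

theorem performed {p : PProp L} (hp : p ∈ D.pprops) :
    Atom.performed (.action p.action) (Term.inst p.inst) (.num p.prob) ∈ Y :=
  hY _ .tt (.inl (.inr ⟨p, hp, rfl⟩)) trivial

theorem fluentOrAction (x : L.Fluent ⊕ L.Action) : Atom.fluentOrAction (Term.symbol x) ∈ Y := by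
  refine hY _ _ (.inr (.pec2 _)) ?_
  rcases x with f | a
  · exact Or.inl (hY.fluent f)
  · exact Or.inr (hY.action a)

theorem possVal (l : Literal L) : Atom.possVal (Term.symbol l.symbol) (.value l.value) ∈ Y := by
  rcases hs : l.symbol with f | a
  · obtain ⟨p, ⟨hp, rfl⟩, -⟩ := D.unique_vprop f
    refine hY _ .tt (.inl (.inl (.inl (.inl (.inr ⟨p, hp, l.value, ?_, rfl⟩))))) trivial
    rw [p.values_eq, ← hs]
    exact l.value_mem
  · obtain rfl | rfl := Literal.eq_performs_or_eq_omits hs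
    · exact hY _ _ (.inr (.pec1_true _)) (hY.action a)
    · exact hY _ _ (.inr (.pec1_false _)) (hY.action a)

theorem literal (l : Literal L) : Atom.literal (Term.ofLiteral l) ∈ Y :=
  hY _ _ (.inr (.pec3 _ _)) (hY.possVal l)

theorem iLiteral (l : Literal L) (i : Fin (maxinst + 1)) :
    Atom.iLiteral (.pair (Term.ofLiteral l) (Term.inst i)) ∈ Y :=
  hY _ _ (.inr (.pec4 _ _)) ⟨hY.literal l, hY.instant i⟩

theorem inOcc {i : Fin (maxinst + 1)} {o : Term L}
    (h : Atom.causesOutcome o (Term.inst i) ∈ Y) : Atom.inOcc (Term.inst i) ∈ Y :=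
  hY _ _ (.inr (.pec8 o _)) ⟨hY.instant i, h⟩

theorem possiblyPerformed {p : PProp L} (hp : p ∈ D.pprops) :
    Atom.possiblyPerformed (.action p.action) (Term.inst p.inst) ∈ Y :=
  hY _ _ (.inr (.pec6 _ _ _)) (hY.performed hp)

theorem definitelyPerformed {p : PProp L} (hp : p ∈ D.pprops) (h1 : p.prob = 1) :
    Atom.definitelyPerformed (.action p.action) (Term.inst p.inst) ∈ Y :=
  hY _ _ (.inr (.pec5 _ _)) (h1 ▸ hY.performed hp)

end Closed

/-- What must be the case for an atom of an answer set `Z` to be derivable: the bodies of the rules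
deriving it, as in the Clark completion, as far as the trace depends on them. The auxiliary
atoms `fluentOrAction` and `eval` do not influence the trace and are left unconstrained. -/
def Explained (T : TranslationChoice D) (Z : Set (Atom L)) : Atom L → Prop
  | .fluent x => ∃ f, x = .fluent f
  | .action x => ∃ a, x = .action a
  | .instant t => ∃ i, t = Term.inst i
  | .possVal x v => (∃ p ∈ D.vprops, ∃ w ∈ p.values, x = .fluent p.fluent ∧ v = .value w) ∨
      Atom.action x ∈ Z ∧ (v = .value L.top ∨ v = .value L.bot)
  | .fluentOrAction _ => True
  | .literal t => ∃ x v, t = .pair x v ∧ Atom.possVal x v ∈ Z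
  | .iLiteral t => ∃ l i, t = .pair l i ∧ Atom.literal l ∈ Z ∧ Atom.instant i ∈ Z
  | .belongsTo t s => ∃ O, Names T s O ∧ ∃ l ∈ O.eff, t = Term.ofLiteral l
  | .causesOutcome o t => ∃ c s O, NamesEffect T c s O ∧ o = .pair s (.num O.prob) ∧
      ∃ conj ∈ T.dnf c, ∀ l ∈ conj, Atom.holds (.pair (Term.ofLiteral l) t) ∈ Z
  | .initialCondition o => ∃ s O, NamesInitial T s O ∧ o = .pair s (.num O.prob)
  | .performed a t p =>
      ∃ q ∈ D.pprops, a = .action q.action ∧ t = Term.inst q.inst ∧ p = .num q.prob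
  | .definitelyPerformed a t => Atom.performed a t (.num 1) ∈ Z
  | .possiblyPerformed a t => ∃ p, Atom.performed a t p ∈ Z
  | .holds t => Atom.iLiteral t ∈ Z
  | .inOcc t => ∃ o, Atom.causesOutcome o t ∈ Z
  | .effectChoice o t => Atom.causesOutcome o t ∈ Z ∧ Atom.inOcc t ∈ Z
  | .initialChoice o => Atom.initialCondition o ∈ Z
  | .eval _ _ _ => True

end Translation

/-! ### The trace of an answer set -/

section FromAnswerSet

variable {maxinst : ℕ} {L : DomainLanguage.{u} (Fin (maxinst + 1))} {D : DomainDescription L}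
  {T : TranslationChoice D}

theorem IsAnswerSet.closed {Z : Set (Atom L)} (hZ : IsAnswerSet (program T) Z) :
    Closed T Z Z :=
  fun _ _ hr hb => hZ.1 _ hr hb

theorem IsAnswerSet.explained {Z : Set (Atom L)} (hZ : IsAnswerSet (program T) Z) {a : Atom L}
    (ha : a ∈ Z) : Explained T Z a := by
  obtain ⟨r, hr, hb, ho⟩ := hZ.exists_offers ha
  rcases hr with ((((((⟨f, rfl⟩ | ⟨f, rfl⟩) | ⟨i, rfl⟩) | ⟨p, hp, v, hv, rfl⟩) |
    ⟨n, c, hc, i, O, hO, l, hl, rfl⟩ | ⟨n, c, hc, i, O, hO, t, rfl⟩) |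
    ⟨j, hj, i, O, hO, l, hl, rfl⟩ | ⟨j, hj, i, O, hO, rfl⟩) | ⟨p, hp, rfl⟩) | hr
  · obtain rfl := ho
    exact ⟨f, rfl⟩
  · obtain rfl := ho
    exact ⟨f, rfl⟩
  · obtain rfl := ho
    exact ⟨i, rfl⟩
  · obtain rfl := ho
    exact Or.inl ⟨p, hp, v, hv, rfl, rfl⟩
  · obtain rfl := ho
    exact ⟨O, Or.inl ⟨c, n, i, hc, hO, rfl⟩, l, hl, rfl⟩
  · obtain rfl := ho
    exact ⟨c, _, O, ⟨n, i, hc, hO, rfl⟩, rfl, holdsBody_holds.1 hb⟩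
  · obtain rfl := ho
    exact ⟨O, Or.inr ⟨j, hj, i, hO, rfl⟩, l, hl, rfl⟩
  · obtain rfl := ho
    exact ⟨_, O, ⟨j, hj, i, hO, rfl⟩, rfl⟩
  · obtain rfl := ho
    exact ⟨p, hp, rfl, rfl, rfl⟩
  · cases hr with
    | pec1_true a => obtain rfl := ho; exact Or.inr ⟨hb, Or.inl rfl⟩
    | pec1_false a => obtain rfl := ho; exact Or.inr ⟨hb, Or.inr rfl⟩
    | pec2 x => obtain rfl := ho; trivial
    | pec3 x v => obtain rfl := ho; exact ⟨x, v, rfl, hb⟩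
    | pec4 l i => obtain rfl := ho; exact ⟨l, i, rfl, hb⟩
    | pec5 a i => obtain rfl := ho; exact hb
    | pec6 a i p => obtain rfl := ho; exact ⟨p, hb⟩
    | pec7 x i =>
      obtain ⟨c, hc, v, hv⟩ := ho
      obtain ⟨rfl, rfl⟩ := Prod.ext_iff.1 hv
      exact hc
    | pec8 o i => obtain rfl := ho; exact ⟨o, hb.2⟩
    | pec9 i =>
      obtain ⟨c, hc, v, hv⟩ := ho
      obtain ⟨rfl, rfl⟩ := Prod.ext_iff.1 hv
      exact ⟨hc, hb⟩
    | pec10 =>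
      obtain ⟨c, hc, v, hv⟩ := ho
      obtain ⟨rfl, rfl⟩ := Prod.ext_iff.1 hv
      exact hc
    | pec17 a i p => obtain rfl := ho; trivial
    | pec18 a i p => obtain rfl := ho; trivial
    | _ => exact ho.elim

namespace IsAnswerSet

variable {Z : Set (Atom L)} (hZ : IsAnswerSet (program T) Z)

include hZ

/-- The literal atoms of an answer set are the translated literals. -/
theorem literal_mem_iff {t : Term L} :
    Atom.literal t ∈ Z ↔ ∃ l : Literal L, t = Term.ofLiteral l := by
  refine ⟨fun h => ?_, ?_⟩
  · obtain ⟨x, v, rfl, h'⟩ := hZ.explained h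
    rcases hZ.explained h' with ⟨p, hp, w, hw, rfl, rfl⟩ | ⟨ha, rfl | rfl⟩
    · exact ⟨⟨Sum.inl p.fluent, w, p.values_eq ▸ hw⟩, rfl⟩
    · obtain ⟨a, rfl⟩ := hZ.explained ha
      exact ⟨.performs a, rfl⟩
    · obtain ⟨a, rfl⟩ := hZ.explained ha
      exact ⟨.omits a, rfl⟩
  · rintro ⟨l, rfl⟩
    exact hZ.closed.literal l

theorem exists_of_holds_mem {t : Term L} (h : Atom.holds t ∈ Z) :
    ∃ (l : Literal L) (i : Fin (maxinst + 1)), t = .pair (Term.ofLiteral l) (Term.inst i) := by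
  obtain ⟨l, i, rfl, hl, hi⟩ := hZ.explained (hZ.explained h)
  obtain ⟨l, rfl⟩ := hZ.literal_mem_iff.1 hl
  obtain ⟨i, rfl⟩ := hZ.explained hi
  exact ⟨l, i, rfl⟩

theorem belongsTo_mem_iff {s : Term L} {O : Outcome L} (hO : Names T s O) {l : Literal L} :
    Atom.belongsTo (Term.ofLiteral l) s ∈ Z ↔ l ∈ O.eff := by
  refine ⟨fun h => ?_, fun h => hZ.closed.belongsTo hO h⟩
  obtain ⟨O', hO', l', hl', h⟩ := hZ.explained h
  rwa [hO.unique hO', Term.ofLiteral_injective h]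

theorem represents_iff {s : Term L} {O O' : Outcome L} (hO : Names T s O) :
    Represents Z s O' ↔ O'.eff = O.eff := by
  simp only [Represents, hZ.belongsTo_mem_iff hO, Set.ext_iff]

theorem existsUnique_holds (i : Fin (maxinst + 1)) (x : L.Fluent ⊕ L.Action) :
    ∃! l : Literal L, Atom.holds (.pair (Term.ofLiteral l) (Term.inst i)) ∈ Z ∧ l.symbol = x := by
  have h := hZ.1 _ (.inr (.pec7 (Term.symbol x) (Term.inst i)))
    ⟨hZ.closed.instant i, hZ.closed.fluentOrAction x⟩
  obtain ⟨a, ⟨ha, c, hc, v, hv⟩, huniq⟩ := Head.sat_choice_one_one.1 h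
  obtain ⟨rfl, rfl⟩ := Prod.ext_iff.1 hv
  obtain ⟨l, i', hl⟩ := hZ.exists_of_holds_mem ha
  simp only [Term.ofLiteral, Term.pair.injEq] at hl
  obtain ⟨⟨hx, rfl⟩, -⟩ := hl
  obtain rfl := Term.symbol_injective hx
  refine ⟨l, ⟨ha, rfl⟩, fun l' ⟨hl', hs⟩ => ?_⟩
  have := huniq _ ⟨hl', _, hZ.closed.iLiteral l' i, .value l'.value, by
    rw [Term.ofLiteral, hs]⟩
  simp only [Term.ofLiteral, Atom.holds.injEq, Term.pair.injEq, Term.value.injEq] at this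
  exact Literal.ext' hs this.1.2

/-- The world described by the `holds` atoms of an answer set. -/
def world : World L := fun i =>
  ⟨{l | Atom.holds (.pair (Term.ofLiteral l) (Term.inst i)) ∈ Z}, hZ.existsUnique_holds i⟩

theorem mem_world_state {l : Literal L} {i : Fin (maxinst + 1)} :
    l ∈ hZ.world.state i ↔ Atom.holds (.pair (Term.ofLiteral l) (Term.inst i)) ∈ Z :=
  Iff.rfl

/-- The `causesOutcome` atoms at an instant are those of the c-propositions activated there; a body
may be replaced by its disjunctive normal form because the `holds` atoms form a state. -/
theorem causesOutcome_mem_iff {o : Term L} {i : Fin (maxinst + 1)} :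
    Atom.causesOutcome o (Term.inst i) ∈ Z ↔ ∃ c s O, NamesEffect T c s O ∧
      o = .pair s (.num O.prob) ∧ D.Activated hZ.world i c := by
  have key : ∀ c ∈ D.cprops, c.body.Holds (hZ.world.state i) ↔
      ∃ conj ∈ T.dnf c, ∀ l ∈ conj, Atom.holds (.pair (Term.ofLiteral l) (Term.inst i)) ∈ Z :=
    fun c hc => T.dnf_isDNF c hc _ (hZ.world.state_mem i)
  constructor
  · intro h
    obtain ⟨c, s, O, hO, rfl, h'⟩ := hZ.explained h
    exact ⟨c, s, O, hO, rfl,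
      DomainDescription.activated_iff.2 ⟨hO.mem.1, (key c hO.mem.1).2 h'⟩⟩
  · rintro ⟨c, s, O, hO, rfl, h⟩
    exact hZ.closed.causesOutcome hO ((key c hO.mem.1).1 (DomainDescription.activated_iff.1 h).2)

theorem inOcc_mem_iff {i : Fin (maxinst + 1)} :
    Atom.inOcc (Term.inst i) ∈ Z ↔ i ∈ D.occ hZ.world := by
  constructor
  · intro h
    obtain ⟨o, h⟩ := hZ.explained h
    obtain ⟨c, s, O, -, -, h⟩ := hZ.causesOutcome_mem_iff.1 h
    exact ⟨c, h⟩
  · rintro ⟨c, h⟩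
    -- The probabilities in a head sum to `1`, so it is not empty.
    obtain ⟨O, hO⟩ : c.head.Nonempty := by
      rw [Finset.nonempty_iff_ne_empty]
      intro h0
      simpa [h0] using c.weight_eq_one
    obtain ⟨s, hs⟩ := exists_namesEffect T h.1 hO
    exact hZ.closed.inOcc (hZ.causesOutcome_mem_iff.2 ⟨c, s, O, hs, rfl, h⟩)

theorem exists_effectChoice {i : Fin (maxinst + 1)} (hi : i ∈ D.occ hZ.world) :
    ∃ c s O, NamesEffect T c s O ∧ D.Activated hZ.world i c ∧
      ∀ o, Atom.effectChoice o (Term.inst i) ∈ Z ↔ o = .pair s (.num O.prob) := by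
  have h := hZ.1 _ (.inr (.pec9 (Term.inst i))) (hZ.inOcc_mem_iff.2 hi)
  obtain ⟨a, ⟨ha, c, hc, o, ho⟩, huniq⟩ := Head.sat_choice_one_one.1 h
  obtain ⟨rfl, rfl⟩ := Prod.ext_iff.1 ho
  obtain ⟨c, s, O, hO, rfl, h⟩ := hZ.causesOutcome_mem_iff.1 hc
  refine ⟨c, s, O, hO, h, fun o => ⟨fun ho => ?_, ?_⟩⟩
  · simpa using huniq _ ⟨ho, _, (hZ.explained ho).1, o, rfl⟩
  · rintro rfl
    exact ha

theorem exists_initialChoice :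
    ∃ s O, NamesInitial T s O ∧ ∀ o, Atom.initialChoice o ∈ Z ↔ o = .pair s (.num O.prob) := by
  have h := hZ.1 _ (.inr .pec10) trivial
  obtain ⟨a, ⟨ha, c, hc, o, ho⟩, huniq⟩ := Head.sat_choice_one_one.1 h
  obtain ⟨rfl, rfl⟩ := Prod.ext_iff.1 ho
  obtain ⟨s, O, hO, rfl⟩ := hZ.explained hc
  refine ⟨s, O, hO, fun o => ⟨fun ho => ?_, ?_⟩⟩
  · simpa using huniq _ ⟨ho, _, hZ.explained ho, o, rfl⟩
  · rintro rfl
    exact ha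

theorem cwa_world : D.CWA hZ.world := by
  constructor
  · intro a i h
    by_contra hno
    refine hZ.1 _ (.inr (.pec11 (.action a) (Term.inst i))) ?_
    simp only [Body.holds_all, List.forall_mem_cons, Body.Holds]
    refine ⟨hZ.closed.action a, hZ.closed.instant i, h, fun hp => hno ?_, by simp⟩
    obtain ⟨p, hp⟩ := hZ.explained hp
    obtain ⟨q, hq, ha, hi, -⟩ := hZ.explained hp
    exact ⟨q, hq, (Term.action.inj ha).symm, (Term.inst_injective hi).symm⟩
  · intro p hp h1
    by_contra hno
    refine hZ.1 _ (.inr (.pec12 (.action p.action) (Term.inst p.inst))) ?_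
    simp only [Body.holds_all, List.forall_mem_cons, Body.Holds]
    exact ⟨hZ.closed.action _, hZ.closed.instant _,
      (omits_mem_iff (hZ.world.state_mem p.inst) p.action).2 hno,
      hZ.closed.definitelyPerformed hp h1, by simp⟩

theorem initConsistent_world {s : Term L} {O : Outcome L} (hO : NamesInitial T s O)
    (h : Atom.initialChoice (.pair s (.num O.prob)) ∈ Z) : D.InitConsistent hZ.world O := by
  refine ⟨hO.isInitialChoice, ?_⟩
  have heff : O.eff ∈ fluentStates L := by
    obtain ⟨j, hj, hO⟩ := hO.isInitialChoice
    exact j.eff_mem O hO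
  have key : ∀ l ∈ O.eff, l ∈ hZ.world.state ⊥ := by
    intro l hl
    by_contra hno
    refine hZ.1 _ (.inr (.pec13 s (.num O.prob) (Term.ofLiteral l))) ?_
    simp only [Body.holds_all, List.forall_mem_cons, Body.Holds, Term.num_eq_inst_zero]
    exact ⟨h, hZ.closed.literal l, hZ.closed.belongsTo (.inr hO) hl, hno, by simp⟩
  -- The effect of `O` assigns a value to every fluent, so there is no room for further literals.
  obtain ⟨S, hS, hSO⟩ := heff
  rw [← hSO, fluentPart_eq_iff hS (hZ.world.state_mem _)]
  intro l hl f hf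
  exact key l (hSO ▸ ⟨hl, f, hf⟩)

theorem fluentPart_world_succ {i i' : Fin (maxinst + 1)} (hi : (i : ℕ) + 1 = i') {s : Term L}
    {O : Outcome L} (hO : Names T s O)
    (h : Atom.effectChoice (.pair s (.num O.prob)) (Term.inst i) ∈ Z) :
    fluentPart (hZ.world.state i') = update (fluentPart (hZ.world.state i)) O.eff := by
  have hlt : ((i : ℕ) : ℝ) < maxinst := by
    have := i'.2
    exact_mod_cast (by omega : (i : ℕ) < maxinst)
  have hi'' : (.num (((i : ℕ) : ℝ) + 1) : Term L) = Term.inst i' := by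
    rw [Term.inst, ← hi, Nat.cast_add, Nat.cast_one]
  rw [fluentPart_eq_update_iff (hZ.world.state_mem _) (hZ.world.state_mem _) O.eff_mem]
  constructor
  · intro l hl
    by_contra hno
    obtain ⟨f, hf⟩ := exists_symbol_of_mem_partialFluentState O.eff_mem hl
    refine hZ.1 _ (.inr (.pec14 (i : ℕ) s (.num O.prob) (Term.symbol l.symbol) (.value l.value)
      hlt)) ?_
    simp only [Body.holds_all, List.forall_mem_cons, Body.Holds, hi'']
    exact ⟨hZ.closed.instant i, h, hf ▸ hZ.closed.fluent f, hZ.closed.belongsTo hO hl, hno,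
      by simp⟩
  · intro l hl f hf hlO
    by_contra hno
    refine hZ.1 _ (.inr (.pec15 (i : ℕ) s (.num O.prob) (Term.symbol l.symbol) (.value l.value)
      hlt)) ?_
    simp only [Body.holds_all, List.forall_mem_cons, Body.Holds, hi'']
    exact ⟨hZ.closed.instant i, hf ▸ hZ.closed.fluent f, hno, h,
      fun hb => hlO ((hZ.belongsTo_mem_iff hO).1 hb), hl, by simp⟩

theorem fluentPart_world_succ_of_not_mem_occ {i i' : Fin (maxinst + 1)} (hi : (i : ℕ) + 1 = i')
    (h : i ∉ D.occ hZ.world) :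
    fluentPart (hZ.world.state i') = fluentPart (hZ.world.state i) := by
  have hlt : ((i : ℕ) : ℝ) < maxinst := by
    have := i'.2
    exact_mod_cast (by omega : (i : ℕ) < maxinst)
  have hi'' : (.num (((i : ℕ) : ℝ) + 1) : Term L) = Term.inst i' := by
    rw [Term.inst, ← hi, Nat.cast_add, Nat.cast_one]
  rw [fluentPart_eq_iff (hZ.world.state_mem _) (hZ.world.state_mem _)]
  intro l hl f hf
  by_contra hno
  refine hZ.1 _ (.inr (.pec16 (i : ℕ) (Term.symbol l.symbol) (.value l.value) hlt)) ?_
  simp only [Body.holds_all, List.forall_mem_cons, Body.Holds, hi'']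
  exact ⟨hf ▸ hZ.closed.fluent f, hZ.closed.instant i, hl,
    fun ho => h (hZ.inOcc_mem_iff.1 ho), hno, by simp⟩

theorem isTrace {tr : CandidateTrace L} (htr : IsTraceOfAnswerSet Z tr) : D.IsTrace tr := by
  obtain ⟨s₀, O₀, hO₀, hs₀⟩ := hZ.exists_initialChoice
  have hinit : D.InitConsistent hZ.world O₀ := hZ.initConsistent_world hO₀ ((hs₀ _).2 rfl)
  have hE : ∀ i : D.occ hZ.world, ∃ c s O, NamesEffect T c s O ∧ D.Activated hZ.world i c ∧
      ∀ o, Atom.effectChoice o (Term.inst i.1) ∈ Z ↔ o = .pair s (.num O.prob) :=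
    fun i => hZ.exists_effectChoice i.2
  choose c s ec hN hact hec using hE
  have hcons : D.EffectConsistent hZ.world ec := by
    refine DomainDescription.effectConsistent_iff.2
      ⟨fun i => ⟨c i, hact i, (hN i).mem.2⟩, fun i i' hi => ⟨fun h => ?_, fun h => ?_⟩⟩
    · exact hZ.fluentPart_world_succ hi (.inl ⟨_, hN ⟨i, h⟩⟩) ((hec ⟨i, h⟩ _).2 rfl)
    · exact hZ.fluentPart_world_succ_of_not_mem_occ hi h
  have hW : D.WellBehaved hZ.world := ⟨hZ.cwa_world, ⟨_, hinit⟩, ⟨_, hcons⟩⟩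
  have hval : ∀ i : D.occ hZ.world, tr.outcomeAt i = some (ec i) := fun i =>
    (htr.2 i _).2 ⟨s i, (hec i _).2 rfl, (hZ.represents_iff (.inl ⟨_, hN i⟩)).2 rfl⟩
  refine ⟨hZ.world, hW, hW, O₀, ec, hinit, hcons, ?_, ?_, hval⟩
  · ext i
    refine ⟨fun ⟨O, hO⟩ => ?_, fun hi => ⟨_, hval ⟨i, hi⟩⟩⟩
    obtain ⟨t, ht, -⟩ := (htr.2 i O).1 hO
    exact hZ.inOcc_mem_iff.1 (hZ.explained ht).2
  · exact (htr.1 _).2 ⟨s₀, (hs₀ _).2 rfl, (hZ.represents_iff (.inr hO₀)).2 rfl⟩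

end IsAnswerSet

end FromAnswerSet

/-! ### The answer set of a world and its choices -/

section ToAnswerSet

variable {maxinst : ℕ} {L : DomainLanguage.{u} (Fin (maxinst + 1))} {D : DomainDescription L}

/-- Membership in the answer set describing the world `W` with initial choice `ic`, named by `s₀`,
and effect choice `ec`, with `ec i` named by `s i`. -/
def Canonical (T : TranslationChoice D) (W : World L) (s₀ : Term L) (ic : Outcome L)
    (s : D.occ W → Term L) (ec : D.occ W → Outcome L) : Atom L → Prop
  | .fluent x => ∃ f, x = .fluent f
  | .action x => ∃ a, x = .action a
  | .instant t => ∃ i, t = Term.inst i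
  | .possVal x v => ∃ l : Literal L, x = Term.symbol l.symbol ∧ v = .value l.value
  | .fluentOrAction x => ∃ y, x = Term.symbol y
  | .literal t => ∃ l, t = Term.ofLiteral l
  | .iLiteral t => ∃ l i, t = .pair (Term.ofLiteral l) (Term.inst i)
  | .belongsTo t s => ∃ O, Names T s O ∧ ∃ l ∈ O.eff, t = Term.ofLiteral l
  -- The instances for terms other than instants matter only if a conjunction is empty.
  | .causesOutcome o t => ∃ c s O, NamesEffect T c s O ∧ o = .pair s (.num O.prob) ∧
      ∃ conj ∈ T.dnf c, ∀ l ∈ conj, ∃ i, t = Term.inst i ∧ l ∈ W.state i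
  | .initialCondition o => ∃ s O, NamesInitial T s O ∧ o = .pair s (.num O.prob)
  | .performed a t p =>
      ∃ q ∈ D.pprops, a = .action q.action ∧ t = Term.inst q.inst ∧ p = .num q.prob
  | .definitelyPerformed a t =>
      ∃ q ∈ D.pprops, a = .action q.action ∧ t = Term.inst q.inst ∧ q.prob = 1
  | .possiblyPerformed a t => ∃ q ∈ D.pprops, a = .action q.action ∧ t = Term.inst q.inst
  | .holds t => ∃ l i, t = .pair (Term.ofLiteral l) (Term.inst i) ∧ l ∈ W.state i
  | .inOcc t => ∃ i ∈ D.occ W, t = Term.inst i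
  | .effectChoice o t => ∃ i, t = Term.inst i.1 ∧ o = .pair (s i) (.num (ec i).prob)
  | .initialChoice o => o = .pair s₀ (.num ic.prob)
  | .eval a t p => ∃ q ∈ D.pprops, a = .action q.action ∧ t = Term.inst q.inst ∧
      (Literal.performs q.action ∈ W.state q.inst ∧ p = .num q.prob ∨
        Literal.omits q.action ∈ W.state q.inst ∧ p = .num (1 - q.prob))

/-- The answer set describing a world together with an initial choice and an effect choice. -/
def canonicalSet (T : TranslationChoice D) (W : World L) (s₀ : Term L) (ic : Outcome L)
    (s : D.occ W → Term L) (ec : D.occ W → Outcome L) : Set (Atom L) :=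
  {a | Canonical T W s₀ ic s ec a}

variable {T : TranslationChoice D} {W : World L} {s₀ : Term L} {ic : Outcome L}
  {s : D.occ W → Term L} {ec : D.occ W → Outcome L}

theorem holds_mem_canonicalSet {l : Literal L} {i : Fin (maxinst + 1)} :
    Atom.holds (.pair (Term.ofLiteral l) (Term.inst i)) ∈ canonicalSet T W s₀ ic s ec ↔
      l ∈ W.state i := by
  refine ⟨?_, fun h => ⟨l, i, rfl, h⟩⟩
  rintro ⟨l', i', h, hl⟩
  obtain ⟨h₁, h₂⟩ := Term.pair.inj h
  rwa [Term.ofLiteral_injective h₁, Term.inst_injective h₂]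

theorem causesOutcome_mem_canonicalSet {o : Term L} {i : Fin (maxinst + 1)} :
    Atom.causesOutcome o (Term.inst i) ∈ canonicalSet T W s₀ ic s ec ↔
      ∃ c s O, NamesEffect T c s O ∧ o = .pair s (.num O.prob) ∧ D.Activated W i c := by
  refine exists_congr fun c => exists_congr fun s' => exists_congr fun O =>
    and_congr_right fun hO => and_congr_right fun _ => ?_
  have hin : ∀ l, (∃ i', (Term.inst i : Term L) = Term.inst i' ∧ l ∈ W.state i') ↔
      l ∈ W.state i := fun l =>
    ⟨fun ⟨i', h, hl⟩ => Term.inst_injective h ▸ hl, fun hl => ⟨i, rfl, hl⟩⟩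
  simp only [hin, DomainDescription.activated_iff, hO.mem.1, true_and]
  exact (T.dnf_isDNF c hO.mem.1 _ (W.state_mem i)).symm

theorem represents_canonicalSet_iff {t : Term L} {O O' : Outcome L} (hO : Names T t O) :
    Represents (canonicalSet T W s₀ ic s ec) t O' ↔ O'.eff = O.eff := by
  rw [Set.ext_iff]
  refine forall_congr' fun l => iff_congr Iff.rfl ⟨?_, fun h => ⟨O, hO, l, h, rfl⟩⟩
  rintro ⟨O'', hO'', l', hl', h⟩
  rwa [hO.unique hO'', Term.ofLiteral_injective h]

/-- No atom can be removed from the canonical set, since each is derived from atoms of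
previous kinds: sorts and literals, `holds`, `causesOutcome`, `inOcc`, `effectChoice`. -/
theorem canonicalSet_subset_of_reduct (hic : NamesInitial T s₀ ic)
    (hs : ∀ i, ∃ c, NamesEffect T c (s i) (ec i) ∧ D.Activated W i c)
    {Y : Set (Atom L)}
    (hY : ∀ r ∈ program T, r.body.Holds (canonicalSet T W s₀ ic s ec) Y →
      r.head.SatReduct (canonicalSet T W s₀ ic s ec) Y) :
    canonicalSet T W s₀ ic s ec ⊆ Y := by
  have hcl : Closed T (canonicalSet T W s₀ ic s ec) Y := fun a b hr hb => hY _ hr hb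
  have hholds : ∀ l i, l ∈ W.state i →
      Atom.holds (.pair (Term.ofLiteral l) (Term.inst i)) ∈ Y := fun l i hl =>
    hY _ (.inr (.pec7 (Term.symbol l.symbol) (Term.inst i)))
      ⟨hcl.instant i, hcl.fluentOrAction _⟩ _ _ ⟨.value l.value, rfl⟩
      (holds_mem_canonicalSet.2 hl) (hcl.iLiteral l i)
  have hcauses : ∀ o i, Atom.causesOutcome o (Term.inst i) ∈ canonicalSet T W s₀ ic s ec →
      Atom.causesOutcome o (Term.inst i) ∈ Y := by
    intro o i h
    obtain ⟨c, s', O, hO, rfl, hact⟩ := causesOutcome_mem_canonicalSet.1 h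
    obtain ⟨conj, hconj, h⟩ := (T.dnf_isDNF c hO.mem.1 _ (W.state_mem i)).1
      (DomainDescription.activated_iff.1 hact).2
    exact hcl.causesOutcome hO ⟨conj, hconj, fun l hl => hholds l i (h l hl)⟩
  have hown : ∀ i, Atom.causesOutcome (.pair (s i) (.num (ec i).prob)) (Term.inst i.1) ∈ Y := by
    intro i
    obtain ⟨c, hc, h⟩ := hs i
    exact hcauses _ _ (causesOutcome_mem_canonicalSet.2 ⟨c, _, _, hc, rfl, h⟩)
  rintro a ha
  cases a with
  | fluent x => obtain ⟨f, rfl⟩ := ha; exact hcl.fluent f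
  | action x => obtain ⟨a, rfl⟩ := ha; exact hcl.action a
  | instant t => obtain ⟨i, rfl⟩ := ha; exact hcl.instant i
  | possVal x v => obtain ⟨l, rfl, rfl⟩ := ha; exact hcl.possVal l
  | fluentOrAction x => obtain ⟨y, rfl⟩ := ha; exact hcl.fluentOrAction y
  | literal t => obtain ⟨l, rfl⟩ := ha; exact hcl.literal l
  | iLiteral t => obtain ⟨l, i, rfl⟩ := ha; exact hcl.iLiteral l i
  | belongsTo t s' => obtain ⟨O, hO, l, hl, rfl⟩ := ha; exact hcl.belongsTo hO hl
  | causesOutcome o t =>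
    obtain ⟨c, s', O, hO, rfl, conj, hconj, h⟩ := ha
    refine hcl.causesOutcome hO ⟨conj, hconj, fun l hl => ?_⟩
    obtain ⟨i, rfl, hi⟩ := h l hl
    exact hholds l i hi
  | initialCondition o => obtain ⟨s', O, hO, rfl⟩ := ha; exact hcl.initialCondition hO
  | performed a t p => obtain ⟨q, hq, rfl, rfl, rfl⟩ := ha; exact hcl.performed hq
  | definitelyPerformed a t =>
    obtain ⟨q, hq, rfl, rfl, h1⟩ := ha
    exact hcl.definitelyPerformed hq h1
  | possiblyPerformed a t => obtain ⟨q, hq, rfl, rfl⟩ := ha; exact hcl.possiblyPerformed hq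
  | holds t => obtain ⟨l, i, rfl, hl⟩ := ha; exact hholds l i hl
  | inOcc t => obtain ⟨i, hi, rfl⟩ := ha; exact hcl.inOcc (hown ⟨i, hi⟩)
  | effectChoice o t =>
    have ha' := ha
    obtain ⟨i, rfl, rfl⟩ := ha
    exact hY _ (.inr (.pec9 (Term.inst i.1))) (hcl.inOcc (hown i)) _ _ ⟨_, rfl⟩ ha' (hown i)
  | initialChoice o =>
    have ha' := ha
    obtain rfl := ha
    exact hY _ (.inr .pec10) trivial _ _ ⟨_, rfl⟩ ha' (hcl.initialCondition hic)
  | eval a t p =>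
    obtain ⟨q, hq, rfl, rfl, ⟨h, rfl⟩ | ⟨h, rfl⟩⟩ := ha
    · refine hcl _ _ (.inr (.pec17 _ _ _)) ?_
      simp only [Body.holds_all, List.forall_mem_cons, Body.Holds]
      exact ⟨hcl.action _, hcl.instant _, hcl.performed hq, hholds _ _ h, by simp⟩
    · refine hcl _ _ (.inr (.pec18 _ _ _)) ?_
      simp only [Body.holds_all, List.forall_mem_cons, Body.Holds]
      exact ⟨hcl.action _, hcl.instant _, hcl.performed hq, hholds _ _ h, by simp⟩

theorem Term.num_eq_inst_iff {r : ℝ} {i : Fin (maxinst + 1)} :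
    (.num r : Term L) = Term.inst i ↔ r = (i : ℕ) := by
  simp [Term.inst]

/-- Before the last instant, the numeral `i + 1` denotes the next instant. -/
theorem exists_succ_instant {i : Fin (maxinst + 1)} (h : ((i : ℕ) : ℝ) < maxinst) :
    ∃ i' : Fin (maxinst + 1), (i : ℕ) + 1 = i' ∧
      (.num (((i : ℕ) : ℝ) + 1) : Term L) = Term.inst i' := by
  have h' : (i : ℕ) < maxinst := by exact_mod_cast h
  exact ⟨⟨i + 1, by omega⟩, rfl, by simp [Term.inst]⟩

theorem canonicalSet_sat (hW : D.CWA W) (hic : NamesInitial T s₀ ic)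
    (hinit : D.InitConsistent W ic)
    (hs : ∀ i, ∃ c, NamesEffect T c (s i) (ec i) ∧ D.Activated W i c)
    (hec : D.EffectConsistent W ec) :
    ∀ r ∈ program T, r.body.Holds (canonicalSet T W s₀ ic s ec) (canonicalSet T W s₀ ic s ec) →
      r.head.Sat (canonicalSet T W s₀ ic s ec) := by
  have hstep := (DomainDescription.effectConsistent_iff.1 hec).2
  intro r hr hb
  rcases hr with ((((((⟨f, rfl⟩ | ⟨a, rfl⟩) | ⟨i, rfl⟩) | ⟨p, hp, v, hv, rfl⟩) |
    ⟨n, c, hc, i, O, hO, l, hl, rfl⟩ | ⟨n, c, hc, i, O, hO, t, rfl⟩) |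
    ⟨j, hj, i, O, hO, l, hl, rfl⟩ | ⟨j, hj, i, O, hO, rfl⟩) | ⟨p, hp, rfl⟩) | hr
  · exact Exists.intro f rfl
  · exact Exists.intro a rfl
  · exact Exists.intro i rfl
  · exact Exists.intro (⟨Sum.inl p.fluent, v, p.values_eq ▸ hv⟩ : Literal L) ⟨rfl, rfl⟩
  · exact Exists.intro O ⟨Or.inl ⟨c, n, i, hc, hO, rfl⟩, l, hl, rfl⟩
  · obtain ⟨conj, hconj, h⟩ := holdsBody_holds.1 hb
    refine Exists.intro c ⟨_, O, ⟨n, i, hc, hO, rfl⟩, rfl, conj, hconj, fun l hl => ?_⟩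
    obtain ⟨l', i', h', hl'⟩ := h l hl
    obtain ⟨h₁, rfl⟩ := Term.pair.inj h'
    exact ⟨i', rfl, Term.ofLiteral_injective h₁ ▸ hl'⟩
  · exact Exists.intro O ⟨Or.inr ⟨j, hj, i, hO, rfl⟩, l, hl, rfl⟩
  · exact Exists.intro _ ⟨O, ⟨j, hj, i, hO, rfl⟩, rfl⟩
  · exact Exists.intro p ⟨hp, rfl, rfl, rfl⟩
  · cases hr with
    | pec1_true x =>
      obtain ⟨a, rfl⟩ := hb
      exact Exists.intro (Literal.performs a) ⟨rfl, rfl⟩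
    | pec1_false x =>
      obtain ⟨a, rfl⟩ := hb
      exact Exists.intro (Literal.omits a) ⟨rfl, rfl⟩
    | pec2 x =>
      rcases hb with ⟨f, rfl⟩ | ⟨a, rfl⟩
      · exact Exists.intro (Sum.inl f) rfl
      · exact Exists.intro (Sum.inr a) rfl
    | pec3 x v =>
      obtain ⟨l, rfl, rfl⟩ := hb
      exact Exists.intro l rfl
    | pec4 l i =>
      obtain ⟨⟨l, rfl⟩, ⟨i, rfl⟩⟩ := hb
      exact Exists.intro l ⟨i, rfl⟩
    | pec5 a i =>
      obtain ⟨q, hq, rfl, rfl, h⟩ := hb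
      exact Exists.intro q ⟨hq, rfl, rfl, (Term.num.inj h).symm⟩
    | pec6 a i p =>
      obtain ⟨q, hq, rfl, rfl, h⟩ := hb
      exact Exists.intro q ⟨hq, rfl, rfl⟩
    | pec7 x i =>
      obtain ⟨⟨i, rfl⟩, ⟨y, rfl⟩⟩ := hb
      obtain ⟨l, ⟨hl, rfl⟩, -⟩ := W.state_mem i y
      refine Head.sat_choice_one_one.2 ⟨.holds (.pair (Term.ofLiteral l) (Term.inst i)),
        ⟨holds_mem_canonicalSet.2 hl, _, ?_, .value l.value, rfl⟩, ?_⟩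
      · exact Exists.intro l ⟨i, rfl⟩
      · rintro a ⟨ha, c, hc, v, hv⟩
        obtain ⟨rfl, rfl⟩ := Prod.ext_iff.1 hv
        obtain ⟨l', i', h, hl'⟩ := ha
        simp only [Term.ofLiteral, Term.pair.injEq] at h
        obtain ⟨⟨h₁, rfl⟩, h₂⟩ := h
        obtain rfl := Term.inst_injective h₂
        rw [eq_of_mem_state (W.state_mem i) hl' hl (Term.symbol_injective h₁).symm]
        rfl
    | pec8 o i =>
      obtain ⟨⟨i, rfl⟩, h⟩ := hb
      obtain ⟨c, s', O, -, -, h⟩ := causesOutcome_mem_canonicalSet.1 h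
      exact Exists.intro i ⟨⟨c, h⟩, rfl⟩
    | pec9 i =>
      obtain ⟨i, hi, rfl⟩ := hb
      obtain ⟨c, hc, h⟩ := hs ⟨i, hi⟩
      refine Head.sat_choice_one_one.2
        ⟨.effectChoice (.pair (s ⟨i, hi⟩) (.num (ec ⟨i, hi⟩).prob)) (Term.inst i),
          ⟨Exists.intro ⟨i, hi⟩ ⟨rfl, rfl⟩, _,
            causesOutcome_mem_canonicalSet.2 ⟨c, _, _, hc, rfl, h⟩, _, rfl⟩, ?_⟩
      rintro a ⟨ha, c', hc', o, ho⟩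
      obtain ⟨rfl, rfl⟩ := Prod.ext_iff.1 ho
      obtain ⟨⟨i', hi'⟩, h', rfl⟩ := ha
      obtain rfl := Term.inst_injective h'
      rfl
    | pec10 =>
      refine Head.sat_choice_one_one.2 ⟨.initialChoice (.pair s₀ (.num ic.prob)),
        ⟨rfl, _, Exists.intro s₀ ⟨ic, hic, rfl⟩, _, rfl⟩, ?_⟩
      rintro a ⟨ha, c', hc', o, ho⟩
      obtain ⟨rfl, rfl⟩ := Prod.ext_iff.1 ho
      exact congrArg _ ha
    | pec11 x t =>
      simp only [Body.holds_all, List.forall_mem_cons, Body.Holds] at hb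
      obtain ⟨⟨a, rfl⟩, ⟨i, rfl⟩, hh, hno, -⟩ := hb
      obtain ⟨p, hp, rfl, rfl⟩ := hW.1 a i
        ((holds_mem_canonicalSet (l := Literal.performs a)).1 hh)
      exact hno (Exists.intro p ⟨hp, rfl, rfl⟩)
    | pec12 x t =>
      simp only [Body.holds_all, List.forall_mem_cons, Body.Holds] at hb
      obtain ⟨-, -, hh, ⟨q, hq, rfl, rfl, h1⟩, -⟩ := hb
      exact (omits_mem_iff (W.state_mem q.inst) q.action).1
        ((holds_mem_canonicalSet (l := Literal.omits q.action)).1 hh) (hW.2 q hq h1)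
    | pec13 s' p l =>
      simp only [Body.holds_all, List.forall_mem_cons, Body.Holds, Term.num_eq_inst_zero] at hb
      obtain ⟨hc, -, ⟨O, hO, l, hl, rfl⟩, hno, -⟩ := hb
      obtain ⟨rfl, rfl⟩ := Term.pair.inj hc
      obtain rfl := hO.unique (.inr hic)
      rw [← hinit.2] at hl
      exact hno (holds_mem_canonicalSet.2 hl.1)
    | pec14 r x p f v hlt =>
      simp only [Body.holds_all, List.forall_mem_cons, Body.Holds] at hb
      obtain ⟨-, ⟨i, hi, hx⟩, -, ⟨O, hO, l, hl, hlt'⟩, hno, -⟩ := hb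
      obtain rfl := Term.num_eq_inst_iff.1 hi
      obtain ⟨rfl, rfl⟩ := Term.pair.inj hx
      obtain ⟨i', hi', hnum⟩ := exists_succ_instant (L := L) hlt
      obtain ⟨c, hc, -⟩ := hs i
      obtain rfl := hO.unique (.inl ⟨c, hc⟩)
      rw [hlt', hnum, holds_mem_canonicalSet] at hno
      exact hno (((fluentPart_eq_update_iff (W.state_mem _) (W.state_mem _) (ec i).eff_mem).1
        ((hstep i.1 i' hi').1 i.2)).1 l hl)
    | pec15 r x p f v hlt =>
      simp only [Body.holds_all, List.forall_mem_cons, Body.Holds] at hb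
      obtain ⟨-, ⟨f, rfl⟩, hno, ⟨i, hi, hx⟩, hnb, hh, -⟩ := hb
      obtain rfl := Term.num_eq_inst_iff.1 hi
      obtain ⟨rfl, rfl⟩ := Term.pair.inj hx
      obtain ⟨i', hi', hnum⟩ := exists_succ_instant (L := L) hlt
      obtain ⟨c, hc, -⟩ := hs i
      rw [hnum] at hh
      obtain ⟨l, i'', h, hl⟩ := hh
      obtain ⟨h₁, h₂⟩ := Term.pair.inj h
      obtain rfl := Term.inst_injective h₂
      have hf : l.symbol = Sum.inl f := by
        simp only [Term.ofLiteral, Term.pair.injEq] at h₁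
        exact (Term.symbol_injective (a₁ := Sum.inl f) h₁.1).symm
      rw [h₁, hi, holds_mem_canonicalSet] at hno
      rw [h₁] at hnb
      exact hno (((fluentPart_eq_update_iff (W.state_mem _) (W.state_mem _) (ec i).eff_mem).1
        ((hstep i.1 i' hi').1 i.2)).2 l hl f hf
          fun h => hnb (Exists.intro (ec i) ⟨.inl ⟨c, hc⟩, l, h, rfl⟩))
    | pec16 r f v hlt =>
      simp only [Body.holds_all, List.forall_mem_cons, Body.Holds] at hb
      obtain ⟨⟨f, rfl⟩, -, ⟨l, i, h, hl⟩, hno, hnh, -⟩ := hb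
      obtain ⟨h₁, hi⟩ := Term.pair.inj h
      obtain rfl := Term.num_eq_inst_iff.1 hi
      obtain ⟨i', hi', hnum⟩ := exists_succ_instant (L := L) hlt
      have hf : l.symbol = Sum.inl f := by
        simp only [Term.ofLiteral, Term.pair.injEq] at h₁
        exact (Term.symbol_injective (a₁ := Sum.inl f) h₁.1).symm
      rw [h₁, hnum, holds_mem_canonicalSet] at hnh
      exact hnh ((fluentPart_eq_iff (W.state_mem _) (W.state_mem _)).1
        ((hstep i i' hi').2 fun h => hno (Exists.intro i ⟨h, hi⟩)) l hl f hf)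
    | pec17 a t p =>
      simp only [Body.holds_all, List.forall_mem_cons, Body.Holds] at hb
      obtain ⟨-, -, ⟨q, hq, rfl, rfl, rfl⟩, hh, -⟩ := hb
      exact Exists.intro q ⟨hq, rfl, rfl,
        Or.inl ⟨(holds_mem_canonicalSet (l := Literal.performs q.action)).1 hh, rfl⟩⟩
    | pec18 a t p =>
      simp only [Body.holds_all, List.forall_mem_cons, Body.Holds] at hb
      obtain ⟨-, -, ⟨q, hq, rfl, rfl, hp⟩, hh, -⟩ := hb
      exact Exists.intro q ⟨hq, rfl, rfl,
        Or.inr ⟨(holds_mem_canonicalSet (l := Literal.omits q.action)).1 hh,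
          by rw [Term.num.inj hp]⟩⟩

theorem DomainDescription.IsTrace.exists_isAnswerSet (T : TranslationChoice D)
    {tr : CandidateTrace L} (h : D.IsTrace tr) :
    ∃ Z, IsAnswerSet (program T) Z ∧ IsTraceOfAnswerSet Z tr := by
  obtain ⟨W, hW, -, ic, ec, hinit, hec, hdom, htr₀, htr⟩ := h
  obtain ⟨s₀, hs₀⟩ := exists_namesInitial T hinit.1
  have hs : ∀ i, ∃ s c, NamesEffect T c s (ec i) ∧ D.Activated W i c := by
    intro i
    obtain ⟨c, hc, hO⟩ := hec.1 i
    obtain ⟨s, hs⟩ := exists_namesEffect T hc.1 hO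
    exact ⟨s, c, hs, hc⟩
  choose s hs using hs
  refine ⟨canonicalSet T W s₀ ic s ec, ⟨canonicalSet_sat hW.1 hs₀ hinit hs hec,
    fun Y hYZ hY => hYZ.antisymm (canonicalSet_subset_of_reduct hs₀ hs hY)⟩, fun O => ?_,
    fun i O => ?_⟩
  · rw [htr₀]
    constructor
    · rintro rfl
      exact ⟨s₀, rfl, (represents_canonicalSet_iff (.inr hs₀)).2 rfl⟩
    · rintro ⟨t, ht, hO⟩
      obtain ⟨rfl, hp⟩ := Term.pair.inj ht
      exact (Outcome.ext' ((represents_canonicalSet_iff (.inr hs₀)).1 hO) (Term.num.inj hp)).symm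
  · constructor
    · intro hO
      have hi : i ∈ D.occ W := hdom ▸ ⟨O, hO⟩
      obtain rfl : ec ⟨i, hi⟩ = O := Option.some_injective _ ((htr ⟨i, hi⟩).symm.trans hO)
      obtain ⟨c, hc, -⟩ := hs ⟨i, hi⟩
      exact ⟨s ⟨i, hi⟩, Exists.intro ⟨i, hi⟩ ⟨rfl, rfl⟩,
        (represents_canonicalSet_iff (.inl ⟨c, hc⟩)).2 rfl⟩
    · rintro ⟨t, ⟨i', hi, ht⟩, hO⟩
      obtain rfl := Term.inst_injective hi
      obtain ⟨rfl, hp⟩ := Term.pair.inj ht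
      obtain ⟨c, hc, -⟩ := hs i'
      rw [htr i', Outcome.ext' ((represents_canonicalSet_iff (.inl ⟨c, hc⟩)).1 hO)
        (Term.num.inj hp)]

end ToAnswerSet

end PEC

theorem mainTheorem2 (maxinst : ℕ) (L : PEC.DomainLanguage (Fin (maxinst + 1)))
    (D : PEC.DomainDescription L) (T : PEC.TranslationChoice D) (tr : PEC.CandidateTrace L) :
    D.IsTrace tr ↔
      ∃ Z : Set (PEC.Atom L),
        PEC.IsAnswerSet (PEC.domainProgram T ∪ PEC.independentProgram L) Z ∧
          PEC.IsTraceOfAnswerSet Z tr :=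
  ⟨fun h => h.exists_isAnswerSet T, fun ⟨_, hZ, htr⟩ => hZ.isTrace htr⟩
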